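/- Theorem 1. Consider a discounted Markov decision process with state space $\mathcal S$ (for instance $[0,1]^d$), finite non-empty action set $\mathcal A$, discount factor $\gamma\in(0,1)$, deterministic transitions ($s\circ a$ denotes the state reached from $s$ by action $a$), and random rewards $\mathcal R(s,a)\in[-R_{\max},R_{\max}]$, $R_{\max}>0$. Let $V^*(s)=\sup_\pi \mathbb E_\pi\big[\sum_{t\ge 0}\gamma^t\mathcal R(s_t,a_t)\mid s_0=s\big]$, the supremum being over stationary randomized policies, and let $\hat V:\mathcal S\to\mathbb R$ be bounded. Fixed-depth Monte Carlo tree search (MCTS) of depth $H\ge 1$, with constants $\alpha^{(h)},\beta^{(h)},\xi^{(h)},\eta^{(h)}$ ($1\le h\le H$), works on the tree rooted at the query state $s$ whose nodes at depth $h$ are the action sequences of length $h$ (a node being identified with the state it leads to). It keeps for each node $p$ a visit count $N(p)$ and a cumulative value $\tilde v(p)$, and for each edge $(p,a)$ a cumulative reward $q(p,a)$, all initially $0$; the node reached from $p$ by action $a$ is written $p\circ a$. Each simulation starts at the root and, at the current node $p$ of depth $h<H$, takes an action maximizing $$\frac{q(p,a)+\gamma\,\tilde v(p\circ a)}{N(p\circ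 a)}+\frac{(\beta^{(h+1)})^{1/\xi^{(h+1)}}\,N(p)^{\alpha^{(h+1)}/\xi^{(h+1)}}}{N(p\circ a)^{1-\eta^{(h+1)}}}$$ (read as $+\infty$ if $N(p\circ a)=0$; ties are broken arbitrarily), and receives a fresh independent sample $r^{(h+1)}$ of the reward of that state and action. When the depth-$H$ node is reached, with state $s^{(H)}$, every node of depth $h\in\{0,\dots,H\}$ on the path has its visit count increased by $1$ and its cumulative value increased by $r^{(h+1)}+\gamma r^{(h+2)}+\dots+\gamma^{H-1-h}r^{(H)}+\gamma^{H-h}\hat V(s^{(H)})$, and every edge on the path has its cumulative reward increased by the reward received on it. The output after $n$ simulations, $\hat V_n(s)$, is the cumulative value of the root divided by $n$. Let $1/2\le\eta<1$, $\eta^{(h)}=\eta$ for $1\le h\le H$, $\alpha^{(H)}=\eta(1-\eta)\,\xi^{(H)}$, and for $1\le h\le H-1$ $$\alpha^{(h)}=\eta(1-\eta)\big(\alpha^{(h+1)}-1\big),\qquad \xi^{(h)}=\alpha^{(h+1)}-1,$$ where $\xi^{(H)}$ is so large that $\alpha^{(1)}>2$. Then there exist constants $\beta^{(1)},\dots,\beta^{(H)}>1$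 such that for every state $s$ there is a constant $C$ with $$\big|\mathbb E[\hat V_n(s)]-V^*(s)\big|\le\gamma^H\,\|\hat V-V^*\|_\infty+C\,n^{\eta-1}\qquad\text{for all } n\ge 1,$$ the expectation on the left existing. The constant $C$ does not depend on $n$ or on how ties are broken. -/

import Mathlib

open MeasureTheory ProbabilityTheory
open scoped Classical

noncomputable section

namespace MCTS

/-- A discounted Markov decision process with deterministic transitions, finitely many actions
(the finiteness of `A` is a type class argument below) and uniformly bounded random rewards:
`next s a` is the state `s ∘ a` reached by taking action `a` in state `s`, and `reward s a` is the
law of the random reward `R(s, a)`. -/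
structure MDP (S A : Type*) where
  next : S → A → S
  reward : S → A → Measure ℝ
  γ : ℝ
  Rmax : ℝ
  γ_pos : 0 < γ
  γ_lt_one : γ < 1
  Rmax_pos : 0 < Rmax
  reward_prob : ∀ s a, IsProbabilityMeasure (reward s a)
  reward_bdd : ∀ s a, ∀ᵐ x ∂(reward s a), x ∈ Set.Icc (-Rmax) Rmax

variable {S A : Type*}

namespace MDP

/-- The mean reward `E[R(s, a)]`. -/
def mean (M : MDP S A) (s : S) (a : A) : ℝ := ∫ x, x ∂(M.reward s a)

/-- The state reached from `s` by a finite sequence of actions, *the most recent action first*: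
`[a_h, …, a_1]` leads to `(…(s ∘ a_1) ∘ …) ∘ a_h`. -/
def stateAt (M : MDP S A) (s : S) : List A → S
  | [] => s
  | a :: p => M.next (M.stateAt s p) a

variable [Fintype A]

/-- A stationary randomized policy: `π s a` is the probability `π(a | s)`. -/
abbrev Policy (S A : Type*) [Fintype A] := S → stdSimplex ℝ A

/-- The probability that the first actions taken from `s` under the policy `π` are those of the
given sequence (most recent action first). -/
def pathProb (M : MDP S A) (π : Policy S A) (s : S) : List A → ℝ
  | [] => 1
  | a :: p => M.pathProb π s p * (π (M.stateAt s p) : A → ℝ) a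

/-- `E_π[R(s_t, a_t) | s_0 = s]`: the expectation over the first `t` actions (which determine
`s_t`, transitions being deterministic), over the action `a_t`, and over the reward. -/
def expReward (M : MDP S A) (π : Policy S A) (s : S) (t : ℕ) : ℝ :=
  ∑ w : Fin t → A, M.pathProb π s (List.ofFn w) *
    ∑ a : A, (π (M.stateAt s (List.ofFn w)) : A → ℝ) a * M.mean (M.stateAt s (List.ofFn w)) a

/-- The value `V^π(s)`: the expected discounted sum of the rewards under `π` started in `s`. -/
def value (M : MDP S A) (π : Policy S A) (s : S) : ℝ := ∑' t : ℕ, M.γ ^ t * M.expReward π s t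

/-- The optimal value function `V^*(s) = sup_π V^π(s)`. -/
def optValue (M : MDP S A) (s : S) : ℝ := ⨆ π : Policy S A, M.value π s

end MDP

/-- The algorithmic constants; index `h` (for `1 ≤ h ≤ H`) is the superscript `(h)`. -/
structure Params where
  α : ℕ → ℝ
  β : ℕ → ℝ
  ξ : ℕ → ℝ
  η : ℕ → ℝ

/-- The statistics kept by the algorithm. A node of the search tree is the list of the actions that
lead to it from the root, most recent action first (so the root is `[]`, the depth of `p` is
`p.length`, and the child of `p` along the edge `a` is `a :: p`).
`N p` is the visit count, `v p` the cumulative node value, `q p a` the cumulative value of the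
edge from `p` labelled `a`. -/
structure Stats (A : Type*) where
  N : List A → ℕ
  v : List A → ℝ
  q : List A → A → ℝ

/-- The initial statistics: everything is zero. -/
def Stats.init : Stats A := ⟨fun _ => 0, fun _ => 0, fun _ _ => 0⟩

/-- The upper confidence index of action `a` at node `p`; it is `+∞` if the child `a :: p` has not
been visited. -/
def index (γ : ℝ) (c : Params) (st : Stats A) (p : List A) (a : A) : EReal :=
  let h := p.length
  if st.N (a :: p) = 0 then ⊤
  else (((st.q p a + γ * st.v (a :: p)) / (st.N (a :: p) : ℝ) +
    c.β (h + 1) ^ (1 / c.ξ (h + 1)) * (st.N p : ℝ) ^ (c.α (h + 1) / c.ξ (h + 1)) /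
      (st.N (a :: p) : ℝ) ^ (1 - c.η (h + 1)) : ℝ) : EReal)

variable [Fintype A]

/-- The set of the actions of maximal index at the node `p`. -/
def argmaxIndex (γ : ℝ) (c : Params) (st : Stats A) (p : List A) : Finset A :=
  Finset.univ.filter fun a => ∀ b, index γ c st p b ≤ index γ c st p a

/-- A tie-breaking rule: in simulation `t`, at node `p`, if `B` is the set of the maximizers, the
action `tie t p B` is taken. -/
abbrev TieRule (A : Type*) := ℕ → List A → Finset A → A

section Algorithm

/- The inputs: the MDP, the value oracle, the root state, the constants; then the tie-breaking rule
and the reward samples: `x p a j` is the `j`-th sample (`j = 0, 1, …`) drawn on the edge `a` out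
of node `p`. -/
variable (M : MDP S A) (Vhat : S → ℝ) (s : S) (c : Params) (tie : TieRule A)
  (x : List A → A → ℕ → ℝ)

/-- The action selected at node `p` in simulation `t`. -/
def select (st : Stats A) (t : ℕ) (p : List A) : A := tie t p (argmaxIndex M.γ c st p)

/-- The leaf reached from node `p` after `k` further selections in simulation `t`. -/
def leaf (st : Stats A) (t : ℕ) : ℕ → List A → List A
  | 0, p => p
  | k + 1, p => leaf st t k (select M c tie st t p :: p)

/-- The reward received in a simulation upon taking action `a` at node `p`: a fresh sample. -/
def received (st : Stats A) (p : List A) (a : A) : ℝ := x p a (st.N (a :: p))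

/-- The discounted return collected from node `p` on when `k` selections remain before the leaf is
reached: `r₁ + γ r₂ + ⋯ + γ^(k-1) r_k + γ^k V̂(leaf state)`. -/
def ret (st : Stats A) (t : ℕ) : ℕ → List A → ℝ
  | 0, p => Vhat (M.stateAt s p)
  | k + 1, p =>
      received x st p (select M c tie st t p) + M.γ * ret st t k (select M c tie st t p :: p)

/-- Simulation number `t` of depth `H`: the nodes visited are the initial segments of the path to
the leaf (that is, the suffixes of the list `ℓ`), and their statistics are updated. -/
def step (H : ℕ) (st : Stats A) (t : ℕ) : Stats A :=
  let ℓ := leaf M c tie st t H []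
  { N := fun p => if p <:+ ℓ then st.N p + 1 else st.N p
    v := fun p =>
      if p <:+ ℓ then st.v p + ret M Vhat s c tie x st t (H - p.length) p else st.v p
    q := fun p a => if (a :: p) <:+ ℓ then st.q p a + received x st p a else st.q p a }

/-- The statistics after `n` simulations. -/
def run (H : ℕ) : ℕ → Stats A
  | 0 => Stats.init
  | t + 1 => step M Vhat s c tie x H (run H t) (t + 1)

/-- The output of fixed-depth-`H` Monte Carlo tree search from the root state `s` after `n`
simulations. -/
def output (H n : ℕ) : ℝ := (run M Vhat s c tie x H n).v [] / n

end Algorithm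

/-- `X p a j` (the reward samples on the edges of the search tree rooted at `s`) are independent
random variables, and each has the law `R(s', a)`, where `s'` is the state of node `p`. -/
structure IsRewardSample (M : MDP S A) (s : S) {Ω : Type*} [MeasurableSpace Ω] (P : Measure Ω)
    (X : List A → A → ℕ → Ω → ℝ) : Prop where
  meas : ∀ p a j, Measurable (X p a j)
  law : ∀ p a j, P.map (X p a j) = M.reward (M.stateAt s p) a
  indep : iIndepFun (fun e : List A × A × ℕ => X e.1 e.2.1 e.2.2) P

/-- `tie` is a (possibly random and history dependent) tie-breaking rule that always picks one of
the maximizers. -/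
structure IsTieRule {Ω : Type*} [MeasurableSpace Ω] (tie : Ω → TieRule A) : Prop where
  meas : ∀ t p B a, MeasurableSet {ω | tie ω t p B = a}
  mem : ∀ ω t p B, B.Nonempty → tie ω t p B ∈ B

end MCTS

end

namespace MCTS

/-! ### Bookkeeping identities of the search tree. -/

section Structure

variable {S A : Type*} [Fintype A] (M : MDP S A) (Vhat : S → ℝ) (s : S) (c : Params)
  (tie : TieRule A) (x : List A → A → ℕ → ℝ) (H : ℕ)

/-! The Bellman operator is a γ-contraction with fixed point `V^*` (`bellman_optValue`), so its
`H`-fold iterate applied to `Vhat` is within `γ^H ‖Vhat - V^*‖` of `V^*`. It remains to show that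
the output approaches this iterate in mean at rate `n^(η-1)`.

The core, `node_error_bounds`, is pathwise. As `α/ξ = η(1-η)` at every level, each inner node is a
bandit whose arm with `m` of the `N` pulls has a bonus of order `N^(η(1-η)) / m^(1-η)`. If the
cumulative error of every arm is at most `L m^η`, a suboptimal arm is pulled at most `O(N^η)` times
plus a power of `L` (`ucb_count_bound`). Hence the error of the node is again of order `N^η`, and
induction runs from the leaves to the root. The only input is that the prefix sums of the samples on
each edge deviate by at most `κ √j`. Adaptive choices and ties do no harm, because the visits to an
edge consume its samples in a fixed order.

Probability enters with `κ = n^δ`. By Hoeffding the deviation bound fails with probability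
exponentially small in `n^(2δ)`, which beats the trivial error `O(n)`. The estimate `κ^e N^η` alone
would cost a factor `κ^e` in the rate. A second, additive estimate `F + n^η + κ^e` is therefore
propagated, where `F` dominates the deviations up to time `n`. Its mean is `O(√n)` by a pathwise
form of Doob's inequality (`runMax_sq_le`, `integral_runMax_le`), and a small `δ` makes `κ^e ≤ n^η`.
-/

theorem leaf_length (st : Stats A) (t k : ℕ) (p : List A) :
    (leaf M c tie st t k p).length = p.length + k := by
  induction k generalizing p with
  | zero => simp [leaf]
  | succ k ih => rw [leaf, ih, List.length_cons]; omega

theorem suffix_leaf (st : Stats A) (t k : ℕ) (p : List A) : p <:+ leaf M c tie st t k p := by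
  induction k generalizing p with
  | zero => simp [leaf]
  | succ k ih => exact (List.suffix_cons _ _).trans (ih _)

/-- The descent is memoryless: the statistics are frozen during a simulation and a selection depends
only on the current node. Restarting at a node of the path thus reproduces the rest of it; `hl`
makes both walks end at the same depth. -/
theorem leaf_eq_of_suffix (st : Stats A) (t k l : ℕ) (r p : List A) (hr : r <:+ p)
    (hp : p <:+ leaf M c tie st t k r) (hl : p.length + l = r.length + k) :
    leaf M c tie st t l p = leaf M c tie st t k r := by
  induction k generalizing r with
  | zero =>
    have h1 := hp.length_le
    have h2 := hr.length_le
    rw [leaf_length] at h1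
    obtain rfl : l = 0 := by omega
    rw [hr.eq_of_length (by omega)]
  | succ k ih =>
    by_cases h : r.length = p.length
    · obtain rfl := hr.eq_of_length h
      obtain rfl : l = k + 1 := by omega
      rfl
    · have h2 := hr.length_le
      rw [leaf] at hp ⊢
      refine ih _ ?_ hp (by rw [List.length_cons]; omega)
      exact List.suffix_of_suffix_length_le (suffix_leaf M c tie st t k _) hp
        (by rw [List.length_cons]; omega)

/-- This turns the global update condition of `step` into a local one at `p`, so that each inner
node can be treated as a bandit. -/
theorem cons_suffix_leaf (st : Stats A) (t : ℕ) (p : List A) (a : A) (hp : p.length < H) :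
    (a :: p) <:+ leaf M c tie st t H [] ↔
      p <:+ leaf M c tie st t H [] ∧ a = select M c tie st t p := by
  constructor
  · intro h
    have h1 : p <:+ leaf M c tie st t H [] := (List.suffix_cons a p).trans h
    refine ⟨h1, ?_⟩
    obtain ⟨l, hl⟩ : ∃ l, p.length + (l + 1) = H := ⟨H - p.length - 1, by omega⟩
    have h2 := leaf_eq_of_suffix M c tie st t H (l + 1) [] p (List.nil_suffix) h1 (by simpa using hl)
    rw [leaf] at h2
    rw [← h2] at h
    have h3 := List.suffix_of_suffix_length_le h (suffix_leaf M c tie st t l _) (by simp)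
    have h4 := h3.eq_of_length (by simp)
    exact (List.cons.inj h4).1
  · rintro ⟨h1, rfl⟩
    obtain ⟨l, hl⟩ : ∃ l, p.length + (l + 1) = H := ⟨H - p.length - 1, by omega⟩
    have h2 := leaf_eq_of_suffix M c tie st t H (l + 1) [] p (List.nil_suffix) h1 (by simpa using hl)
    rw [← h2, leaf]
    exact suffix_leaf M c tie st t l _

/-- At an inner node on the path of a simulation exactly one child count goes up. -/
theorem step_N_cons (st : Stats A) (t : ℕ) (p : List A) (a : A) (hp : p.length < H) :
    (step M Vhat s c tie x H st t).N (a :: p) =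
      if p <:+ leaf M c tie st t H [] ∧ a = select M c tie st t p then st.N (a :: p) + 1
      else st.N (a :: p) := by
  simp only [step, cons_suffix_leaf M c tie H st t p a hp]

theorem run_N_eq_sum (t : ℕ) (p : List A) (hp : p.length < H) :
    (run M Vhat s c tie x H t).N p = ∑ a, (run M Vhat s c tie x H t).N (a :: p) := by
  induction t with
  | zero => simp [run, Stats.init]
  | succ t ih =>
    rw [run]
    simp only [step_N_cons M Vhat s c tie x H _ _ p _ hp]
    simp only [step]
    by_cases h : p <:+ leaf M c tie (run M Vhat s c tie x H t) (t + 1) H []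
    · simp only [h, true_and, if_true]
      rw [ih]
      have : ∀ a, (if a = select M c tie (run M Vhat s c tie x H t) (t + 1) p then
          (run M Vhat s c tie x H t).N (a :: p) + 1 else (run M Vhat s c tie x H t).N (a :: p)) =
          (run M Vhat s c tie x H t).N (a :: p) +
            if a = select M c tie (run M Vhat s c tie x H t) (t + 1) p then 1 else 0 := by
        intro a; split_ifs <;> rfl
      simp [this, Finset.sum_add_distrib]
    · simp [h, ih]

/-- The return from `p` is the reward plus `γ` times the return from the selected child, and both
are credited in the same simulation. Arm `a` of the bandit at `p` therefore has total payoff `q p a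
+ γ v (a :: p)`. -/
theorem run_v_eq_sum (t : ℕ) (p : List A) (hp : p.length < H) :
    (run M Vhat s c tie x H t).v p =
      ∑ a, ((run M Vhat s c tie x H t).q p a + M.γ * (run M Vhat s c tie x H t).v (a :: p)) := by
  induction t with
  | zero => simp [run, Stats.init]
  | succ t ih =>
    rw [run]
    simp only [step, cons_suffix_leaf M c tie H _ _ p _ hp]
    by_cases h : p <:+ leaf M c tie (run M Vhat s c tie x H t) (t + 1) H []
    · simp only [h, true_and, if_true]
      rw [ih]
      obtain ⟨l, hl⟩ : ∃ l, H - p.length = l + 1 := ⟨H - p.length - 1, by omega⟩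
      have hl' : ∀ a : A, H - (a :: p).length = l := by
        intro a; rw [List.length_cons]; omega
      simp only [hl, hl', ret]
      generalize run M Vhat s c tie x H t = st
      have : ∀ a, ((if a = select M c tie st (t + 1) p then st.q p a + received x st p a
          else st.q p a) + M.γ * (if a = select M c tie st (t + 1) p then
            st.v (a :: p) + ret M Vhat s c tie x st (t + 1) l (a :: p) else st.v (a :: p))) =
          (st.q p a + M.γ * st.v (a :: p)) + if a = select M c tie st (t + 1) p then
            received x st p a + M.γ * ret M Vhat s c tie x st (t + 1) l (a :: p) else 0 := by
        intro a; split_ifs <;> ring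
      simp only [this]
      rw [Finset.sum_add_distrib (f := fun a => st.q p a + M.γ * st.v (a :: p))]
      simp
    · simp [h, ih]

/-- The visit count indexes the next sample, so only prefixes of the sample sequence of an edge ever
occur, however adaptively the edge was chosen. -/
theorem run_q_eq_sum (t : ℕ) (p : List A) (a : A) :
    (run M Vhat s c tie x H t).q p a =
      ∑ j ∈ Finset.range ((run M Vhat s c tie x H t).N (a :: p)), x p a j := by
  induction t with
  | zero => simp [run, Stats.init]
  | succ t ih =>
    rw [run]
    simp only [step]
    split_ifs
    · rw [Finset.sum_range_succ, ih, received]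
    · exact ih

theorem run_v_leaf (t : ℕ) (p : List A) (hp : p.length = H) :
    (run M Vhat s c tie x H t).v p = (run M Vhat s c tie x H t).N p * Vhat (M.stateAt s p) := by
  induction t with
  | zero => simp [run, Stats.init]
  | succ t ih =>
    rw [run]
    simp only [step, hp, Nat.sub_self, ret]
    split_ifs
    · rw [ih]; push_cast; ring
    · exact ih

theorem run_N_root (t : ℕ) : (run M Vhat s c tie x H t).N [] = t := by
  induction t with
  | zero => simp [run, Stats.init]
  | succ t ih => rw [run]; simp [step, ih]

theorem run_N_mono (t : ℕ) (p : List A) :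
    (run M Vhat s c tie x H t).N p ≤ (run M Vhat s c tie x H (t + 1)).N p := by
  rw [run]
  simp only [step]
  split_ifs <;> omega

theorem run_N_le (t : ℕ) (p : List A) : (run M Vhat s c tie x H t).N p ≤ t := by
  induction t with
  | zero => simp [run, Stats.init]
  | succ t ih =>
    rw [run]
    simp only [step]
    split_ifs <;> omega

end Structure

end MCTS

/-! ### Pathwise analysis: upper confidence selection and propagation of errors. -/

namespace MCTS

/-- If the upper confidence index of an arm with mean `μa` dominates that of an arm with the larger
mean `μs`, the former arm has been pulled at most of the order of `N ^ η` times. -/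
theorem ucb_count_bound {η B L N m k Qa Qs μa μs : ℝ} (hη : 0 < η) (hη1 : η < 1)
    (hB : 1 ≤ B) (hL : 1 ≤ L) (hΔ : 0 < μs - μa) (hm : 1 ≤ m) (hmN : m ≤ N) (hk : 1 ≤ k)
    (hQa : |Qa - m * μa| ≤ L * m ^ η) (hQs : |Qs - k * μs| ≤ L * k ^ η)
    (hidx : Qs / k + B * N ^ (η * (1 - η)) / k ^ (1 - η) ≤
      Qa / m + B * N ^ (η * (1 - η)) / m ^ (1 - η)) :
    m ≤ (2 * B / (μs - μa)) ^ (1 / (1 - η)) * N ^ η + L ^ (1 / (η * (1 - η))) := by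
  have h1 : 0 < 1 - η := by linarith
  have hm0 : 0 < m := by linarith
  have hk0 : 0 < k := by linarith
  have hN0 : 0 < N := by linarith
  have hs : 0 < η * (1 - η) := by positivity
  set T := N ^ (η * (1 - η)) with hT
  have hT0 : 0 < T := by positivity
  -- If the bonus dominates the error scale, the index of the better arm is at least `μs` and that
  -- of the other at most `μa` plus twice its bonus, which bounds `m`. Otherwise `N` itself is at
  -- most a power of `L`, and `m ≤ N`.
  by_cases hLT : L ≤ B * T
  · have key : ∀ y : ℝ, 0 < y → y ^ η / y = 1 / y ^ (1 - η) := by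
      intro y hy
      have : y ^ η * y ^ (1 - η) = y := by
        rw [← Real.rpow_add hy]; simp
      have h2 : 0 < y ^ (1 - η) := by positivity
      rw [div_eq_div_iff hy.ne' h2.ne', this, one_mul]
    have ha : Qa / m ≤ μa + L / m ^ (1 - η) := by
      have : L / m ^ (1 - η) = L * m ^ η / m := by
        rw [mul_div_assoc, key m hm0]; ring
      rw [this, div_le_iff₀ hm0, add_mul, div_mul_cancel₀ _ hm0.ne']
      linarith [(abs_le.mp hQa).2]
    have hb : μs - L / k ^ (1 - η) ≤ Qs / k := by
      have : L / k ^ (1 - η) = L * k ^ η / k := by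
        rw [mul_div_assoc, key k hk0]; ring
      rw [this, le_div_iff₀ hk0, sub_mul, div_mul_cancel₀ _ hk0.ne']
      linarith [(abs_le.mp hQs).1]
    have hm1 : 0 < m ^ (1 - η) := by positivity
    have hk1 : 0 < k ^ (1 - η) := by positivity
    have hc : L / k ^ (1 - η) ≤ B * T / k ^ (1 - η) := by gcongr
    have hd : L / m ^ (1 - η) ≤ B * T / m ^ (1 - η) := by gcongr
    have he : μs - μa ≤ 2 * B * T / m ^ (1 - η) := by
      have : 2 * B * T / m ^ (1 - η) = B * T / m ^ (1 - η) + B * T / m ^ (1 - η) := by ring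
      linarith
    have hf : m ^ (1 - η) ≤ 2 * B / (μs - μa) * T := by
      rw [le_div_iff₀ hm1] at he
      rw [div_mul_eq_mul_div, le_div_iff₀ hΔ]
      linarith
    have hg : m ≤ (2 * B / (μs - μa) * T) ^ (1 / (1 - η)) := by
      calc m = (m ^ (1 - η)) ^ (1 / (1 - η)) := by
            rw [← Real.rpow_mul hm0.le, mul_one_div_cancel h1.ne', Real.rpow_one]
        _ ≤ _ := by
            apply Real.rpow_le_rpow hm1.le hf (by positivity)
    -- The exponent `η(1-η)` of the bonus is what makes the number of pulls come out as `N^η`.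
    have hh : T ^ (1 / (1 - η)) = N ^ η := by
      rw [hT, ← Real.rpow_mul hN0.le]
      congr 1
      field_simp
    rw [Real.mul_rpow (by positivity) hT0.le, hh] at hg
    have : 0 ≤ L ^ (1 / (η * (1 - η))) := by positivity
    linarith
  · have hTL : T ≤ L := by nlinarith
    have hg : N ≤ L ^ (1 / (η * (1 - η))) := by
      calc N = T ^ (1 / (η * (1 - η))) := by
            rw [hT, ← Real.rpow_mul hN0.le, mul_one_div_cancel hs.ne', Real.rpow_one]
        _ ≤ _ := by
            apply Real.rpow_le_rpow hT0.le hTL (by positivity)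
    have : 0 ≤ (2 * B / (μs - μa)) ^ (1 / (1 - η)) * N ^ η := by positivity
    linarith

section

variable {S A : Type*} [Fintype A] [Nonempty A]

namespace MDP

/-- The `k`-fold iterate of the Bellman optimality operator, applied to `Vhat`. -/
noncomputable def bellmanIter (M : MDP S A) (Vhat : S → ℝ) : ℕ → S → ℝ
  | 0 => Vhat
  | k + 1 => fun s => Finset.univ.sup' Finset.univ_nonempty fun a =>
      M.mean s a + M.γ * bellmanIter M Vhat k (M.next s a)

theorem le_bellmanIter_succ (M : MDP S A) (Vhat : S → ℝ) (k : ℕ) (s : S) (a : A) :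
    M.mean s a + M.γ * M.bellmanIter Vhat k (M.next s a) ≤ M.bellmanIter Vhat (k + 1) s := by
  rw [bellmanIter]
  exact Finset.le_sup' (fun a => M.mean s a + M.γ * M.bellmanIter Vhat k (M.next s a))
    (Finset.mem_univ a)

theorem exists_bellmanIter_succ_eq (M : MDP S A) (Vhat : S → ℝ) (k : ℕ) (s : S) :
    ∃ a, M.bellmanIter Vhat (k + 1) s = M.mean s a + M.γ * M.bellmanIter Vhat k (M.next s a) := by
  obtain ⟨a, -, ha⟩ := Finset.exists_mem_eq_sup' (Finset.univ_nonempty (α := A))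
    (fun a => M.mean s a + M.γ * M.bellmanIter Vhat k (M.next s a))
  exact ⟨a, ha⟩

end MDP

theorem argmaxIndex_nonempty (γ : ℝ) (c : Params) (st : Stats A) (p : List A) :
    (argmaxIndex γ c st p).Nonempty := by
  obtain ⟨a, -, ha⟩ := Finset.exists_max_image Finset.univ (index γ c st p) Finset.univ_nonempty
  exact ⟨a, by simpa [argmaxIndex] using ha⟩

/-- The comparison of indices that holds when a visited child is selected again. -/
theorem index_le_of_select (M : MDP S A) (c : Params) (tie : TieRule A)
    (htie : ∀ t p B, B.Nonempty → tie t p B ∈ B) (st : Stats A) (t : ℕ) (p : List A) (a b : A)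
    (ha : a = select M c tie st t p) (hN : st.N (a :: p) ≠ 0) :
    st.N (b :: p) ≠ 0 ∧
    (st.q p b + M.γ * st.v (b :: p)) / (st.N (b :: p) : ℝ) +
      c.β (p.length + 1) ^ (1 / c.ξ (p.length + 1)) *
        (st.N p : ℝ) ^ (c.α (p.length + 1) / c.ξ (p.length + 1)) /
        (st.N (b :: p) : ℝ) ^ (1 - c.η (p.length + 1)) ≤
    (st.q p a + M.γ * st.v (a :: p)) / (st.N (a :: p) : ℝ) +
      c.β (p.length + 1) ^ (1 / c.ξ (p.length + 1)) *
        (st.N p : ℝ) ^ (c.α (p.length + 1) / c.ξ (p.length + 1)) /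
        (st.N (a :: p) : ℝ) ^ (1 - c.η (p.length + 1)) := by
  have h1 := htie t p _ (argmaxIndex_nonempty M.γ c st p)
  change select M c tie st t p ∈ _ at h1
  rw [← ha, argmaxIndex, Finset.mem_filter] at h1
  have h2 := h1.2 b
  -- An unvisited child has index `⊤` and would beat the finite index of `a`.
  have hb : st.N (b :: p) ≠ 0 := by
    intro hb
    rw [index, index] at h2
    simp only [hb, hN, if_true, if_false] at h2
    exact EReal.coe_ne_top _ (top_le_iff.mp h2)
  refine ⟨hb, ?_⟩
  rw [index, index] at h2
  simp only [hb, hN, if_false] at h2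
  exact EReal.coe_le_coe_iff.mp h2

/-- The number of visits to a suboptimal child, given error bounds at all the children. -/
theorem suboptimal_visits_le (M : MDP S A) (Vhat : S → ℝ) (s : S) (c : Params) (tie : TieRule A)
    (x : List A → A → ℕ → ℝ) (H : ℕ) (htie : ∀ t p B, B.Nonempty → tie t p B ∈ B)
    {η : ℝ} (hη : 0 < η) (hη1 : η < 1) (p : List A) (hp : p.length < H)
    (hcη : c.η (p.length + 1) = η)
    (hcα : c.α (p.length + 1) / c.ξ (p.length + 1) = η * (1 - η))
    (hcβ : 1 ≤ c.β (p.length + 1) ^ (1 / c.ξ (p.length + 1)))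
    (μ : A → ℝ) (L : ℝ) (hL : 1 ≤ L) (n : ℕ)
    (herr : ∀ t ≤ n, ∀ a, |(run M Vhat s c tie x H t).q p a +
        M.γ * (run M Vhat s c tie x H t).v (a :: p) - (run M Vhat s c tie x H t).N (a :: p) * μ a| ≤
      L * ((run M Vhat s c tie x H t).N (a :: p) : ℝ) ^ η)
    (a b : A) (hab : 0 < μ b - μ a) (t : ℕ) (ht : t ≤ n) :
    ((run M Vhat s c tie x H t).N (a :: p) : ℝ) ≤
      (2 * c.β (p.length + 1) ^ (1 / c.ξ (p.length + 1)) / (μ b - μ a)) ^ (1 / (1 - η)) *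
        ((run M Vhat s c tie x H t).N p : ℝ) ^ η + L ^ (1 / (η * (1 - η))) + 1 := by
  set B := c.β (p.length + 1) ^ (1 / c.ξ (p.length + 1)) with hB
  induction t with
  | zero =>
    have : 0 ≤ (2 * B / (μ b - μ a)) ^ (1 / (1 - η)) *
        ((run M Vhat s c tie x H 0).N p : ℝ) ^ η + L ^ (1 / (η * (1 - η))) + 1 := by positivity
    simpa [run, Stats.init] using this
  | succ t ih =>
    have ih := ih (by omega)
    have hmono : ((run M Vhat s c tie x H t).N p : ℝ) ^ η ≤
        ((run M Vhat s c tie x H (t + 1)).N p : ℝ) ^ η := by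
      have := run_N_mono M Vhat s c tie x H t p
      gcongr
    have hD : 0 ≤ (2 * B / (μ b - μ a)) ^ (1 / (1 - η)) := by positivity
    have hL0 : 0 ≤ L ^ (1 / (η * (1 - η))) := by positivity
    have hmono' := mul_le_mul_of_nonneg_left hmono hD
    have hstep : ((run M Vhat s c tie x H (t + 1)).N (a :: p)) =
        if p <:+ leaf M c tie (run M Vhat s c tie x H t) (t + 1) H [] ∧
          a = select M c tie (run M Vhat s c tie x H t) (t + 1) p then
          (run M Vhat s c tie x H t).N (a :: p) + 1
        else (run M Vhat s c tie x H t).N (a :: p) := by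
      rw [run]; exact step_N_cons M Vhat s c tie x H _ _ p a hp
    rw [hstep]
    -- The count changes only when `a` is selected. On the first visit there is no index comparison;
    -- on later ones the comparison bounds the count before the pull. The final `+ 1` covers the
    -- pull in both cases.
    split_ifs with h
    · by_cases h0 : (run M Vhat s c tie x H t).N (a :: p) = 0
      · rw [h0]
        have : 0 ≤ (2 * B / (μ b - μ a)) ^ (1 / (1 - η)) *
          ((run M Vhat s c tie x H (t + 1)).N p : ℝ) ^ η := by positivity
        push_cast
        linarith
      · obtain ⟨hb, hidx⟩ := index_le_of_select M c tie htie _ _ p a b h.2 h0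
        rw [hcη, hcα, ← hB] at hidx
        have hle : (run M Vhat s c tie x H t).N (a :: p) ≤ (run M Vhat s c tie x H t).N p := by
          rw [run_N_eq_sum M Vhat s c tie x H t p hp]
          exact Finset.single_le_sum (f := fun a => (run M Vhat s c tie x H t).N (a :: p))
            (fun _ _ => Nat.zero_le _) (Finset.mem_univ a)
        have := ucb_count_bound hη hη1 hcβ hL hab
          (by exact_mod_cast Nat.one_le_iff_ne_zero.mpr h0) (by exact_mod_cast hle)
          (by exact_mod_cast Nat.one_le_iff_ne_zero.mpr hb) (herr t (by omega) a)
          (herr t (by omega) b) hidx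
        push_cast
        linarith
    · linarith

/-- Pathwise error bounds at the nodes of the search tree: if the centred partial sums of the first
`n` reward samples on every edge are at most `κ * j ^ (1/2)` and at most `F`, the cumulative value
of a node is within `C * κ ^ e * N ^ η`, and within `C * (F + n ^ η + κ ^ e)`, of `N` times the
value of the corresponding Bellman iterate. -/
theorem node_error_bounds (M : MDP S A) (Vhat : S → ℝ) (s : S) (c : Params) (H : ℕ)
    {η : ℝ} (hη : 1 / 2 ≤ η) (hη1 : η < 1) (hcη : ∀ h, c.η h = η)
    (hcα : ∀ h, 1 ≤ h → h ≤ H → c.α h / c.ξ h = η * (1 - η))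
    (hcβ : ∀ h, 1 ≤ h → h ≤ H → 1 ≤ c.β h ^ (1 / c.ξ h)) (k : ℕ) (p : List A)
    (hp : p.length + k = H) :
    ∃ C e : ℝ, 0 ≤ C ∧ 0 ≤ e ∧ ∀ (tie : TieRule A) (x : List A → A → ℕ → ℝ) (n : ℕ) (κ F : ℝ),
      (∀ t p B, B.Nonempty → tie t p B ∈ B) → 1 ≤ κ → 0 ≤ F →
      (∀ p a j, p.length < H → j ≤ n →
        |∑ i ∈ Finset.range j, x p a i - j * M.mean (M.stateAt s p) a| ≤ κ * (j : ℝ) ^ (1 / 2 : ℝ) ∧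
        |∑ i ∈ Finset.range j, x p a i - j * M.mean (M.stateAt s p) a| ≤ F) →
      ∀ t ≤ n,
        |(run M Vhat s c tie x H t).v p -
          (run M Vhat s c tie x H t).N p * M.bellmanIter Vhat k (M.stateAt s p)| ≤
            C * κ ^ e * ((run M Vhat s c tie x H t).N p : ℝ) ^ η ∧
        |(run M Vhat s c tie x H t).v p -
          (run M Vhat s c tie x H t).N p * M.bellmanIter Vhat k (M.stateAt s p)| ≤
            C * (F + (n : ℝ) ^ η + κ ^ e) := by
  have hη0 : 0 < η := by linarith
  induction k generalizing p with
  | zero =>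
    refine ⟨0, 0, le_rfl, le_rfl, ?_⟩
    intro tie x n κ F htie hκ hF hx t ht
    rw [run_v_leaf M Vhat s c tie x H t p (by omega), MDP.bellmanIter]
    simp
  | succ k ih =>
    choose Cc ec hCc hec hch using fun a : A =>
      ih (a :: p) (by rw [List.length_cons]; omega)
    have hpH : p.length < H := by omega
    set sp := M.stateAt s p with hsp
    set μ : A → ℝ := fun a => M.mean sp a + M.γ * M.bellmanIter Vhat k (M.next sp a) with hμ
    set w := M.bellmanIter Vhat (k + 1) sp with hw
    obtain ⟨b, hb⟩ : ∃ b, w = μ b := M.exists_bellmanIter_succ_eq Vhat k sp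
    have hμw : ∀ a, μ a ≤ w := fun a => M.le_bellmanIter_succ Vhat k sp a
    set B := c.β (p.length + 1) ^ (1 / c.ξ (p.length + 1)) with hB
    have hB1 : 1 ≤ B := hcβ _ (by omega) (by omega)
    set C1 := 1 + ∑ a, Cc a with hC1
    set e1 := 1 + ∑ a, ec a with he1
    have hC1' : 1 ≤ C1 := by
      have := Finset.sum_nonneg fun a (_ : a ∈ Finset.univ) => hCc a
      linarith
    have he1' : 1 ≤ e1 := by
      have := Finset.sum_nonneg fun a (_ : a ∈ Finset.univ) => hec a
      linarith
    have hCca : ∀ a, 1 + Cc a ≤ C1 := by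
      intro a
      have := Finset.single_le_sum (fun a (_ : a ∈ Finset.univ) => hCc a) (Finset.mem_univ a)
      linarith
    have heca : ∀ a, ec a ≤ e1 := by
      intro a
      have := Finset.single_le_sum (fun a (_ : a ∈ Finset.univ) => hec a) (Finset.mem_univ a)
      linarith
    set r := 1 / (η * (1 - η)) with hr
    have hr0 : 0 < r := by
      have : 0 < 1 - η := by linarith
      positivity
    -- For an optimal arm the division is by zero, harmlessly: `D a` is then multiplied by `w - μ a
    -- = 0`.
    set D : A → ℝ := fun a => (2 * B / (w - μ a)) ^ (1 / (1 - η)) with hD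
    have hD0 : ∀ a, 0 ≤ D a := by
      intro a
      have := hμw a
      have h2 : 0 ≤ w - μ a := by linarith
      positivity
    -- The cost of the suboptimal visits. The factor 2 absorbs the `+ 1` of `suboptimal_visits_le`.
    set G := ∑ a, (w - μ a) * (D a + 2 * C1 ^ r) with hG
    have hC1r : 1 ≤ C1 ^ r := Real.one_le_rpow hC1' hr0.le
    have hG0 : 0 ≤ G := by
      refine Finset.sum_nonneg fun a _ => mul_nonneg (by linarith [hμw a]) ?_
      linarith [hD0 a]
    set K := (Fintype.card A : ℝ) with hK
    have hK0 : 0 ≤ K := by positivity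
    -- `K * C1` pays for the errors of the arms, of scale `C1 * κ ^ e1`. The visit bound raises this
    -- scale to the power `r`, whence `e1 * r`.
    refine ⟨K * C1 + G, e1 + e1 * r, by positivity, by positivity, ?_⟩
    intro tie x n κ F htie hκ hF hx t ht
    have hκe : ∀ y z : ℝ, y ≤ z → κ ^ y ≤ κ ^ z := fun y z h => Real.rpow_le_rpow_of_exponent_le hκ h
    set L := C1 * κ ^ e1 with hLdef
    have hκ1 : 1 ≤ κ ^ e1 := Real.one_le_rpow hκ (by linarith)
    have hL1 : 1 ≤ L := one_le_mul_of_one_le_of_one_le hC1' hκ1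
    have hγ0 := M.γ_pos
    have hγ1 := M.γ_lt_one
    have harm : ∀ u : ℕ, u ≤ n → ∀ a, (run M Vhat s c tie x H u).q p a +
          M.γ * (run M Vhat s c tie x H u).v (a :: p) -
          (run M Vhat s c tie x H u).N (a :: p) * μ a =
        (∑ i ∈ Finset.range ((run M Vhat s c tie x H u).N (a :: p)), x p a i -
          (run M Vhat s c tie x H u).N (a :: p) * M.mean sp a) +
        M.γ * ((run M Vhat s c tie x H u).v (a :: p) - (run M Vhat s c tie x H u).N (a :: p) *
          M.bellmanIter Vhat k (M.stateAt s (a :: p))) := by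
      intro u hu a
      rw [run_q_eq_sum, hμ]
      simp only [MDP.stateAt]
      ring
    have harm1 : ∀ u : ℕ, u ≤ n → ∀ a, |(run M Vhat s c tie x H u).q p a +
          M.γ * (run M Vhat s c tie x H u).v (a :: p) -
          (run M Vhat s c tie x H u).N (a :: p) * μ a| ≤
        L * ((run M Vhat s c tie x H u).N (a :: p) : ℝ) ^ η := by
      intro u hu a
      rw [harm u hu a]
      set m := (run M Vhat s c tie x H u).N (a :: p) with hm
      have hmn : m ≤ n := (run_N_le M Vhat s c tie x H u _).trans hu
      have h1 := (hx p a m hpH hmn).1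
      have h2 := (hch a tie x n κ F htie hκ hF hx u hu).1
      rw [← hm] at h2
      have h3 : (m : ℝ) ^ (1 / 2 : ℝ) ≤ (m : ℝ) ^ η := by
        rcases Nat.eq_zero_or_pos m with h | h
        · rw [h]; simp [hη0.ne']
        · exact Real.rpow_le_rpow_of_exponent_le (by exact_mod_cast h) hη
      have hmη : 0 ≤ (m : ℝ) ^ η := by positivity
      have h4 : κ ≤ κ ^ e1 := by simpa using hκe 1 e1 he1'
      have h5 : κ * (m : ℝ) ^ (1 / 2 : ℝ) ≤ κ ^ e1 * (m : ℝ) ^ η := by gcongr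
      have h6 : Cc a * κ ^ ec a * (m : ℝ) ^ η ≤ Cc a * κ ^ e1 * (m : ℝ) ^ η := by
        have := hκe _ _ (heca a)
        have := hCc a
        gcongr
      refine (abs_add_le _ _).trans ?_
      rw [abs_mul, abs_of_pos hγ0]
      have h7 : (1 + Cc a) * (κ ^ e1 * (m : ℝ) ^ η) ≤ L * (m : ℝ) ^ η := by
        rw [hLdef, mul_assoc]
        have := hCca a
        gcongr
      have h8 := mul_le_of_le_one_left (abs_nonneg ((run M Vhat s c tie x H u).v (a :: p) -
        m * M.bellmanIter Vhat k (M.stateAt s (a :: p)))) hγ1.le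
      linarith
    have harm2 : ∀ a, |(run M Vhat s c tie x H t).q p a +
          M.γ * (run M Vhat s c tie x H t).v (a :: p) -
          (run M Vhat s c tie x H t).N (a :: p) * μ a| ≤
        C1 * (F + (n : ℝ) ^ η + κ ^ (e1 + e1 * r)) := by
      intro a
      rw [harm t ht a]
      set m := (run M Vhat s c tie x H t).N (a :: p) with hm
      have hmn : m ≤ n := (run_N_le M Vhat s c tie x H t _).trans ht
      have h1 := (hx p a m hpH hmn).2
      have h2 := (hch a tie x n κ F htie hκ hF hx t ht).2
      rw [← hm] at h2
      refine (abs_add_le _ _).trans ?_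
      rw [abs_mul, abs_of_pos hγ0]
      have h8 := mul_le_of_le_one_left (abs_nonneg ((run M Vhat s c tie x H t).v (a :: p) -
        m * M.bellmanIter Vhat k (M.stateAt s (a :: p)))) hγ1.le
      have hn0 : 0 ≤ (n : ℝ) ^ η := by positivity
      have hk0 : 0 ≤ κ ^ (e1 + e1 * r) := by positivity
      have h9 : κ ^ ec a ≤ κ ^ (e1 + e1 * r) := hκe _ _ (by
        have := heca a
        have : 0 ≤ e1 * r := by positivity
        linarith)
      have h10 : Cc a * (F + (n : ℝ) ^ η + κ ^ ec a) ≤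
          Cc a * (F + (n : ℝ) ^ η + κ ^ (e1 + e1 * r)) := by
        have := hCc a
        gcongr
      have h11 : (1 + Cc a) * (F + (n : ℝ) ^ η + κ ^ (e1 + e1 * r)) ≤
          C1 * (F + (n : ℝ) ^ η + κ ^ (e1 + e1 * r)) := by
        have := hCca a
        gcongr
      linarith
    have hLr : L ^ r = C1 ^ r * κ ^ (e1 * r) := by
      rw [hLdef, Real.mul_rpow (by linarith) (by linarith), ← Real.rpow_mul (by linarith)]
    have hκ2 : 1 ≤ κ ^ (e1 * r) := Real.one_le_rpow hκ (by positivity)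
    have hκ3 : κ ^ (e1 * r) ≤ κ ^ (e1 + e1 * r) := hκe _ _ (by linarith)
    have hκ4 : κ ^ e1 ≤ κ ^ (e1 + e1 * r) := hκe _ _ (by nlinarith)
    have hvis : ∀ a, (w - μ a) * ((run M Vhat s c tie x H t).N (a :: p) : ℝ) ≤
        (w - μ a) * (D a * ((run M Vhat s c tie x H t).N p : ℝ) ^ η +
          2 * C1 ^ r * κ ^ (e1 * r)) := by
      intro a
      rcases (hμw a).eq_or_lt with h | h
      · rw [h]; simp
      · have := suboptimal_visits_le M Vhat s c tie x H htie hη0 hη1 p hpH (hcη _)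
          (hcα _ (by omega) (by omega)) hB1 μ L hL1 n harm1 a b (by rw [← hb]; linarith) t ht
        rw [← hb, ← hB, ← hr, hLr] at this
        refine mul_le_mul_of_nonneg_left (this.trans ?_) (by linarith)
        have h2 : 1 ≤ C1 ^ r * κ ^ (e1 * r) := one_le_mul_of_one_le_of_one_le hC1r hκ2
        linarith
    -- Regret decomposition: errors of the arms about their own means, minus the loss of visiting
    -- suboptimal arms.
    have hsum : (run M Vhat s c tie x H t).v p - (run M Vhat s c tie x H t).N p * w =
        ∑ a, ((run M Vhat s c tie x H t).q p a +
          M.γ * (run M Vhat s c tie x H t).v (a :: p) -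
          (run M Vhat s c tie x H t).N (a :: p) * μ a) -
        ∑ a, (w - μ a) * ((run M Vhat s c tie x H t).N (a :: p) : ℝ) := by
      rw [run_v_eq_sum M Vhat s c tie x H t p hpH, run_N_eq_sum M Vhat s c tie x H t p hpH]
      push_cast
      rw [Finset.sum_mul, ← Finset.sum_sub_distrib, ← Finset.sum_sub_distrib]
      exact Finset.sum_congr rfl fun a _ => by ring
    have habs : |(run M Vhat s c tie x H t).v p - (run M Vhat s c tie x H t).N p * w| ≤
        ∑ a, |(run M Vhat s c tie x H t).q p a +
          M.γ * (run M Vhat s c tie x H t).v (a :: p) -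
          (run M Vhat s c tie x H t).N (a :: p) * μ a| +
        ∑ a, (w - μ a) * ((run M Vhat s c tie x H t).N (a :: p) : ℝ) := by
      rw [hsum]
      refine (abs_sub _ _).trans (add_le_add (Finset.abs_sum_le_sum_abs _ _) (le_of_eq ?_))
      refine abs_of_nonneg (Finset.sum_nonneg fun a _ => mul_nonneg (by linarith [hμw a]) ?_)
      positivity
    have hNle : ∀ a, (run M Vhat s c tie x H t).N (a :: p) ≤ (run M Vhat s c tie x H t).N p := by
      intro a
      rw [run_N_eq_sum M Vhat s c tie x H t p hpH]
      exact Finset.single_le_sum (f := fun a => (run M Vhat s c tie x H t).N (a :: p))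
        (fun _ _ => Nat.zero_le _) (Finset.mem_univ a)
    set N := (run M Vhat s c tie x H t).N p with hNdef
    have hNn : N ≤ n := (run_N_le M Vhat s c tie x H t p).trans ht
    have hvis' : ∀ y : ℝ, 0 ≤ y → (N : ℝ) ^ η ≤ y → 1 ≤ y →
        ∑ a, (w - μ a) * ((run M Vhat s c tie x H t).N (a :: p) : ℝ) ≤
          G * κ ^ (e1 * r) * y := by
      intro y hy0 hy hy1
      rw [hG, Finset.sum_mul, Finset.sum_mul]
      refine Finset.sum_le_sum fun a _ => (hvis a).trans ?_
      rw [mul_assoc (w - μ a), mul_assoc (w - μ a)]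
      refine mul_le_mul_of_nonneg_left ?_ (by linarith [hμw a])
      have h1 : D a * (N : ℝ) ^ η ≤ D a * (κ ^ (e1 * r) * y) := by
        refine mul_le_mul_of_nonneg_left ?_ (hD0 a)
        calc (N : ℝ) ^ η ≤ 1 * y := by linarith
          _ ≤ _ := by gcongr
      have h2 : 2 * C1 ^ r * κ ^ (e1 * r) * 1 ≤ 2 * C1 ^ r * κ ^ (e1 * r) * y := by gcongr
      linarith
    -- The first bound feeds the index comparison one level up. In the second, `harm2` keeps `F`
    -- additive and free of powers of `κ`. An unvisited node is treated separately in the first,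
    -- since `N ^ η` is then `0` and cannot absorb constants.
    constructor
    · rcases Nat.eq_zero_or_pos N with h0 | h0
      · have hz : ∀ a, (run M Vhat s c tie x H t).N (a :: p) = 0 := fun a => by
          have := hNle a; omega
        have h1 : ∀ a, |(run M Vhat s c tie x H t).q p a +
          M.γ * (run M Vhat s c tie x H t).v (a :: p) -
          (run M Vhat s c tie x H t).N (a :: p) * μ a| ≤ 0 := fun a => by
            simpa [hz a, hη0.ne'] using harm1 t ht a
        refine habs.trans ?_
        have h2 := Finset.sum_nonpos fun a (_ : a ∈ Finset.univ) => h1 a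
        simp only [hz]
        rw [h0]
        simpa [hη0.ne', hz] using h2
      · have hN1 : 1 ≤ (N : ℝ) ^ η := Real.one_le_rpow (by exact_mod_cast h0) hη0.le
        refine habs.trans ?_
        have h1 : ∑ a, |(run M Vhat s c tie x H t).q p a +
          M.γ * (run M Vhat s c tie x H t).v (a :: p) -
          (run M Vhat s c tie x H t).N (a :: p) * μ a| ≤ K * (L * (N : ℝ) ^ η) := by
          have := Finset.sum_le_card_nsmul Finset.univ _ (L * (N : ℝ) ^ η)
            fun a _ => (harm1 t ht a).trans (by
              have := hNle a
              have : ((run M Vhat s c tie x H t).N (a :: p) : ℝ) ≤ N := by exact_mod_cast this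
              gcongr)
          simpa [hK] using this
        have h2 := hvis' _ (by positivity) le_rfl hN1
        have h3 : K * (L * (N : ℝ) ^ η) ≤ K * C1 * κ ^ (e1 + e1 * r) * (N : ℝ) ^ η := by
          rw [hLdef]
          calc K * (C1 * κ ^ e1 * (N : ℝ) ^ η) = K * C1 * κ ^ e1 * (N : ℝ) ^ η := by ring
            _ ≤ _ := by gcongr
        have h4 : G * κ ^ (e1 * r) * (N : ℝ) ^ η ≤ G * κ ^ (e1 + e1 * r) * (N : ℝ) ^ η := by
          gcongr
        linarith
    · refine habs.trans ?_
      have h1 : ∑ a, |(run M Vhat s c tie x H t).q p a +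
          M.γ * (run M Vhat s c tie x H t).v (a :: p) -
          (run M Vhat s c tie x H t).N (a :: p) * μ a| ≤
            K * (C1 * (F + (n : ℝ) ^ η + κ ^ (e1 + e1 * r))) := by
        have := Finset.sum_le_card_nsmul Finset.univ _
          (C1 * (F + (n : ℝ) ^ η + κ ^ (e1 + e1 * r))) fun a _ => harm2 a
        simpa [hK] using this
      have h2 : ∑ a, (w - μ a) * ((run M Vhat s c tie x H t).N (a :: p) : ℝ) ≤
          G * ((n : ℝ) ^ η + κ ^ (e1 + e1 * r)) := by
        rw [hG, Finset.sum_mul]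
        refine Finset.sum_le_sum fun a _ => (hvis a).trans ?_
        rw [mul_assoc (w - μ a)]
        refine mul_le_mul_of_nonneg_left ?_ (by linarith [hμw a])
        have hn : (N : ℝ) ^ η ≤ (n : ℝ) ^ η := by gcongr
        have hn0 : 0 ≤ (N : ℝ) ^ η := by positivity
        have hk0 : 0 ≤ κ ^ (e1 + e1 * r) := by positivity
        have h5 : D a * (N : ℝ) ^ η ≤ D a * ((n : ℝ) ^ η + κ ^ (e1 + e1 * r)) :=
          mul_le_mul_of_nonneg_left (by linarith) (hD0 a)
        have h6 : 2 * C1 ^ r * κ ^ (e1 * r) ≤ 2 * C1 ^ r * ((n : ℝ) ^ η + κ ^ (e1 + e1 * r)) :=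
          mul_le_mul_of_nonneg_left (by linarith) (by linarith)
        linarith
      have h3 : G * ((n : ℝ) ^ η + κ ^ (e1 + e1 * r)) ≤
          G * (F + (n : ℝ) ^ η + κ ^ (e1 + e1 * r)) :=
        mul_le_mul_of_nonneg_left (by linarith) hG0
      linarith

end

end MCTS

/-! ### Policy values and the Bellman optimality equation. -/

namespace MCTS.MDP

variable {S A : Type*} (M : MDP S A)

theorem abs_mean_le (s : S) (a : A) : |M.mean s a| ≤ M.Rmax := by
  have := M.reward_prob s a
  have h := norm_integral_le_of_norm_le_const (μ := M.reward s a) (f := fun x : ℝ => x)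
    (C := M.Rmax) (by
      filter_upwards [M.reward_bdd s a] with x hx
      exact abs_le.mpr hx)
  simpa [mean] using h

theorem stateAt_append_singleton (s : S) (p : List A) (a : A) :
    M.stateAt s (p ++ [a]) = M.stateAt (M.next s a) p := by
  induction p with
  | nil => rfl
  | cons b p ih => rw [List.cons_append, stateAt, stateAt, ih]

theorem hasSum_discount : HasSum (fun t => M.γ ^ t * M.Rmax) (M.Rmax / (1 - M.γ)) := by
  have := (hasSum_geometric_of_lt_one M.γ_pos.le M.γ_lt_one).mul_right M.Rmax
  rwa [inv_mul_eq_div] at this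

variable [Fintype A] (π : Policy S A)

theorem pathProb_append_singleton (s : S) (p : List A) (a : A) :
    M.pathProb π s (p ++ [a]) = (π s : A → ℝ) a * M.pathProb π (M.next s a) p := by
  induction p with
  | nil => simp [pathProb, stateAt]
  | cons b p ih => rw [List.cons_append, pathProb, pathProb, ih, stateAt_append_singleton, mul_assoc]

theorem expReward_zero (s : S) :
    M.expReward π s 0 = ∑ a, (π s : A → ℝ) a * M.mean s a := by
  simp [expReward, pathProb, stateAt]

theorem expReward_succ (s : S) (t : ℕ) :
    M.expReward π s (t + 1) = ∑ a, (π s : A → ℝ) a * M.expReward π (M.next s a) t := by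
  -- Conditioning on the first action, which is the last entry of the list.
  rw [expReward, ← Equiv.sum_comp (Fin.snocEquiv fun _ : Fin (t + 1) => A), Fintype.sum_prod_type]
  refine Finset.sum_congr rfl fun a _ => ?_
  rw [expReward, Finset.mul_sum]
  refine Finset.sum_congr rfl fun w _ => ?_
  have h : List.ofFn (Fin.snocEquiv (fun _ : Fin (t + 1) => A) (a, w)) = List.ofFn w ++ [a] := by
    rw [List.ofFn_succ']
    simp [Fin.snocEquiv]
  rw [h, pathProb_append_singleton, stateAt_append_singleton, mul_assoc]

theorem policy_sum (s : S) : ∑ a, (π s : A → ℝ) a = 1 := (π s).2.2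

theorem policy_nonneg (s : S) (a : A) : 0 ≤ (π s : A → ℝ) a := (π s).2.1 a

theorem policy_avg_le {s : S} {f : A → ℝ} {C : ℝ} (hf : ∀ a, f a ≤ C) :
    ∑ a, (π s : A → ℝ) a * f a ≤ C := by
  calc ∑ a, (π s : A → ℝ) a * f a ≤ ∑ a, (π s : A → ℝ) a * C :=
        Finset.sum_le_sum fun a _ => mul_le_mul_of_nonneg_left (hf a) (policy_nonneg π s a)
    _ = C := by rw [← Finset.sum_mul, policy_sum, one_mul]

theorem abs_policy_avg_le {s : S} {f : A → ℝ} {C : ℝ} (hf : ∀ a, |f a| ≤ C) :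
    |∑ a, (π s : A → ℝ) a * f a| ≤ C := by
  refine abs_le.mpr ⟨?_, policy_avg_le π fun a => (abs_le.mp (hf a)).2⟩
  have := policy_avg_le π (s := s) (f := fun a => - f a) (C := C)
    fun a => by linarith [(abs_le.mp (hf a)).1]
  simp only [mul_neg, Finset.sum_neg_distrib] at this
  linarith

theorem abs_expReward_le (s : S) (t : ℕ) : |M.expReward π s t| ≤ M.Rmax := by
  induction t generalizing s with
  | zero => rw [expReward_zero]; exact abs_policy_avg_le π fun a => M.abs_mean_le s a
  | succ t ih => rw [expReward_succ]; exact abs_policy_avg_le π fun a => ih _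

theorem abs_discounted_le (s : S) (t : ℕ) :
    ‖M.γ ^ t * M.expReward π s t‖ ≤ M.γ ^ t * M.Rmax := by
  have := M.γ_pos
  rw [Real.norm_eq_abs, abs_mul, abs_of_pos (by positivity)]
  exact mul_le_mul_of_nonneg_left (M.abs_expReward_le π s t) (by positivity)

theorem summable_discounted (s : S) : Summable fun t => M.γ ^ t * M.expReward π s t :=
  Summable.of_norm_bounded M.hasSum_discount.summable (M.abs_discounted_le π s)

theorem abs_value_le (s : S) : |M.value π s| ≤ M.Rmax / (1 - M.γ) :=
  tsum_of_norm_bounded M.hasSum_discount (M.abs_discounted_le π s)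

/-- The Bellman equation of a policy. -/
theorem value_eq (s : S) :
    M.value π s =
      ∑ a, (π s : A → ℝ) a * (M.mean s a + M.γ * M.value π (M.next s a)) := by
  rw [value, (M.summable_discounted π s).tsum_eq_zero_add, expReward_zero]
  simp only [expReward_succ, mul_add, Finset.sum_add_distrib, pow_zero, one_mul]
  congr 1
  have : ∀ t, M.γ ^ (t + 1) * ∑ a, (π s : A → ℝ) a * M.expReward π (M.next s a) t =
      ∑ a, (π s : A → ℝ) a * (M.γ * (M.γ ^ t * M.expReward π (M.next s a) t)) := by
    intro t
    rw [Finset.mul_sum]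
    exact Finset.sum_congr rfl fun a _ => by ring
  simp only [this]
  rw [Summable.tsum_finsetSum fun a _ =>
    ((M.summable_discounted π (M.next s a)).mul_left _).mul_left _]
  simp only [tsum_mul_left, value]

theorem bddAbove_value (s : S) : BddAbove (Set.range fun π : Policy S A => M.value π s) :=
  ⟨M.Rmax / (1 - M.γ), by rintro _ ⟨π, rfl⟩; exact (abs_le.mp (M.abs_value_le π s)).2⟩

theorem value_le_optValue (s : S) : M.value π s ≤ M.optValue s :=
  le_ciSup (M.bddAbove_value s) π

/-- The policy that plays the action `f s` in state `s`. -/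
noncomputable def detPolicy (f : S → A) : Policy S A :=
  fun s => ⟨Pi.single (f s) 1, single_mem_stdSimplex ℝ (f s)⟩

theorem detPolicy_avg (f : S → A) (s : S) (g : A → ℝ) :
    ∑ a, (detPolicy f s : A → ℝ) a * g a = g (f s) := by
  simp [detPolicy, Pi.single_apply]

/-- A bounded function below its one-step lookahead under a policy is below the value. -/
theorem le_value_of_le_lookahead (U : S → ℝ) {K : ℝ} (hK : ∀ s, |U s| ≤ K)
    (hU : ∀ s, U s ≤ ∑ a, (π s : A → ℝ) a * (M.mean s a + M.γ * U (M.next s a))) (s : S) :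
    U s ≤ M.value π s := by
  have hγ := M.γ_pos
  -- Each use of the Bellman equation of `π` gains a factor `γ` on the crude initial bound.
  have key : ∀ k : ℕ, ∀ s, U s - M.value π s ≤ M.γ ^ k * (K + M.Rmax / (1 - M.γ)) := by
    intro k
    induction k with
    | zero =>
      intro s
      have h1 := (abs_le.mp (hK s)).2
      have h2 := (abs_le.mp (M.abs_value_le π s)).1
      linarith
    | succ k ih =>
      intro s
      have h1 := hU s
      rw [M.value_eq π s]
      have h2 : ∑ a, (π s : A → ℝ) a * (M.mean s a + M.γ * U (M.next s a)) -
          ∑ a, (π s : A → ℝ) a * (M.mean s a + M.γ * M.value π (M.next s a)) =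
          ∑ a, (π s : A → ℝ) a * (M.γ * (U (M.next s a) - M.value π (M.next s a))) := by
        rw [← Finset.sum_sub_distrib]
        exact Finset.sum_congr rfl fun a _ => by ring
      have h3 := policy_avg_le π (s := s)
        (f := fun a => M.γ * (U (M.next s a) - M.value π (M.next s a)))
        (C := M.γ ^ (k + 1) * (K + M.Rmax / (1 - M.γ))) fun a => by
          rw [pow_succ', mul_assoc]
          exact mul_le_mul_of_nonneg_left (ih _) hγ.le
      linarith
  have hlim := (tendsto_pow_atTop_nhds_zero_of_lt_one hγ.le M.γ_lt_one).mul_const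
    (K + M.Rmax / (1 - M.γ))
  rw [zero_mul] at hlim
  linarith [ge_of_tendsto' hlim fun k => key k s]

variable [Nonempty A]

theorem nonempty_policy : Nonempty (Policy S A) :=
  ⟨detPolicy fun _ => Classical.arbitrary A⟩

theorem abs_optValue_le (s : S) : |M.optValue s| ≤ M.Rmax / (1 - M.γ) := by
  have := nonempty_policy (S := S) (A := A)
  refine abs_le.mpr ⟨?_, ciSup_le fun π => (abs_le.mp (M.abs_value_le π s)).2⟩
  let π := Classical.arbitrary (Policy S A)
  exact (abs_le.mp (M.abs_value_le π s)).1.trans (M.value_le_optValue π s)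

/-- One application of the Bellman optimality operator. -/
noncomputable def bellman (V : S → ℝ) (s : S) : ℝ :=
  Finset.univ.sup' Finset.univ_nonempty fun a => M.mean s a + M.γ * V (M.next s a)

theorem optValue_le_bellman (s : S) : M.optValue s ≤ M.bellman M.optValue s := by
  have := nonempty_policy (S := S) (A := A)
  refine ciSup_le fun π => ?_
  rw [value_eq]
  refine policy_avg_le π fun a => ?_
  refine le_trans ?_ (Finset.le_sup'
    (fun a => M.mean s a + M.γ * M.optValue (M.next s a)) (Finset.mem_univ a))
  have := mul_le_mul_of_nonneg_left (M.value_le_optValue π (M.next s a)) M.γ_pos.le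
  linarith

/-- The Bellman optimality equation. -/
theorem bellman_optValue (s : S) : M.bellman M.optValue s = M.optValue s := by
  have hmax : ∀ s, ∃ a, M.bellman M.optValue s = M.mean s a + M.γ * M.optValue (M.next s a) := by
    intro s
    obtain ⟨a, -, ha⟩ := Finset.exists_mem_eq_sup' (Finset.univ_nonempty (α := A))
      (fun a => M.mean s a + M.γ * M.optValue (M.next s a))
    exact ⟨a, ha⟩
  -- The policy greedy for `V^*` attains `V^*`: its one-step lookahead of `V^*` is the Bellman
  -- operator, which dominates `V^*`. Its own Bellman equation is then the optimality equation.
  choose f hf using hmax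
  have hle : ∀ s, M.optValue s ≤ M.value (detPolicy f) s := by
    refine M.le_value_of_le_lookahead (detPolicy f) M.optValue M.abs_optValue_le fun s => ?_
    rw [detPolicy_avg, ← hf]
    exact M.optValue_le_bellman s
  have heq : ∀ s, M.optValue s = M.value (detPolicy f) s := fun s =>
    le_antisymm (hle s) (M.value_le_optValue _ s)
  rw [hf, heq s, value_eq, detPolicy_avg, ← heq]

/-- The Bellman optimality operator is a contraction. -/
theorem abs_bellmanIter_sub_optValue_le (Vhat : S → ℝ) {K : ℝ}
    (hK : ∀ s, |Vhat s - M.optValue s| ≤ K) (k : ℕ) (s : S) :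
    |M.bellmanIter Vhat k s - M.optValue s| ≤ M.γ ^ k * K := by
  induction k generalizing s with
  | zero => simpa [bellmanIter] using hK s
  | succ k ih =>
    have hγ := M.γ_pos
    have h : ∀ a, |M.γ * (M.bellmanIter Vhat k (M.next s a) - M.optValue (M.next s a))| ≤
        M.γ ^ (k + 1) * K := by
      intro a
      rw [abs_mul, abs_of_pos hγ, pow_succ', mul_assoc]
      exact mul_le_mul_of_nonneg_left (ih _) hγ.le
    rw [← M.bellman_optValue s]
    refine abs_le.mpr ⟨?_, ?_⟩
    · suffices M.bellman M.optValue s ≤ M.bellmanIter Vhat (k + 1) s + M.γ ^ (k + 1) * K by linarith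
      refine Finset.sup'_le _ _ fun a _ => ?_
      have h1 := M.le_bellmanIter_succ Vhat k s a
      have h2 := (abs_le.mp (h a)).1
      linarith
    · obtain ⟨a, ha⟩ := M.exists_bellmanIter_succ_eq Vhat k s
      have h1 : M.mean s a + M.γ * M.optValue (M.next s a) ≤ M.bellman M.optValue s :=
        Finset.le_sup' (fun a => M.mean s a + M.γ * M.optValue (M.next s a)) (Finset.mem_univ a)
      have h2 := (abs_le.mp (h a)).2
      rw [ha]
      linarith

end MCTS.MDP

/-! ### Maximal and tail inequalities for sums of bounded centred variables. -/

namespace MCTS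

/-- The running maximum of a sequence started at `0`. -/
noncomputable def runMax (z : ℕ → ℝ) : ℕ → ℝ
  | 0 => 0
  | n + 1 => max (runMax z n) (z (n + 1))

theorem runMax_nonneg (z : ℕ → ℝ) (n : ℕ) : 0 ≤ runMax z n := by
  induction n with
  | zero => exact le_rfl
  | succ n ih => exact ih.trans (le_max_left _ _)

theorem le_runMax (z : ℕ → ℝ) (hz : z 0 = 0) {j n : ℕ} (h : j ≤ n) : z j ≤ runMax z n := by
  induction n with
  | zero => obtain rfl : j = 0 := by omega
            exact hz.le
  | succ n ih =>
    rcases Nat.lt_or_ge n j with hj | hj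
    · obtain rfl : j = n + 1 := by omega
      exact le_max_right _ _
    · exact (ih hj).trans (le_max_left _ _)

theorem runMax_le (z : ℕ → ℝ) {n : ℕ} {K : ℝ} (hK : 0 ≤ K) (h : ∀ j ≤ n, z j ≤ K) :
    runMax z n ≤ K := by
  induction n with
  | zero => exact hK
  | succ n ih => exact max_le (ih fun j hj => h j (by omega)) (h _ le_rfl)

theorem runMax_congr {z w : ℕ → ℝ} {n : ℕ} (h : ∀ j ≤ n, z j = w j) : runMax z n = runMax w n := by
  induction n with
  | zero => rfl
  | succ n ih => rw [runMax, runMax, ih fun j hj => h j (by omega), h _ le_rfl]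

theorem measurable_runMax {Ω : Type*} [MeasurableSpace Ω] {Z : ℕ → Ω → ℝ}
    (hZ : ∀ j, Measurable (Z j)) (n : ℕ) : Measurable fun ω => runMax (fun j => Z j ω) n := by
  induction n with
  | zero => exact measurable_const
  | succ n ih => exact ih.max (hZ _)

/-- A pathwise form of Doob's maximal inequality in `L²`. -/
theorem runMax_sq_le (z : ℕ → ℝ) (n : ℕ) :
    runMax z n ^ 2 ≤
      4 * z n ^ 2 - 4 * ∑ k ∈ Finset.range n, runMax z k * (z (k + 1) - z k) := by
  -- By summation by parts the right side is `∑ z (k+1) * (runMax z (k+1) - runMax z k)`. Wherever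
  -- the maximum increases it equals `z (k+1)`, so the sum dominates the telescoping sum of half the
  -- squares.
  have key : runMax z n ^ 2 / 2 ≤
      runMax z n * z n - ∑ k ∈ Finset.range n, runMax z k * (z (k + 1) - z k) := by
    induction n with
    | zero => simp [runMax]
    | succ n ih =>
      rw [Finset.sum_range_succ, runMax]
      rcases le_total (runMax z n) (z (n + 1)) with h | h
      · rw [max_eq_right h]
        nlinarith [sq_nonneg (z (n + 1) - runMax z n)]
      · rw [max_eq_left h]
        nlinarith
  nlinarith [sq_nonneg (runMax z n - 2 * z n)]

section Independent

variable {Ω : Type*} [MeasurableSpace Ω] {P : Measure Ω}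
  {Y : ℕ → Ω → ℝ} {R : ℝ}

theorem ae_abs_sum_le (hb : ∀ i, ∀ᵐ ω ∂P, |Y i ω| ≤ R) :
    ∀ᵐ ω ∂P, ∀ n : ℕ, |∑ i ∈ Finset.range n, Y i ω| ≤ n * R := by
  filter_upwards [ae_all_iff.mpr hb] with ω hω n
  refine (Finset.abs_sum_le_sum_abs _ _).trans ?_
  simpa using Finset.sum_le_card_nsmul (Finset.range n) (fun i => |Y i ω|) R fun i _ => hω i

/-- The maximum up to `k` involves only `Y i` with `i < k`. This makes the sum in `runMax_sq_le`
vanish in expectation. -/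
theorem indepFun_runMax (hm : ∀ i, Measurable (Y i)) (hi : iIndepFun Y P) (k : ℕ) :
    IndepFun (fun ω => runMax (fun j => ∑ i ∈ Finset.range j, Y i ω) k) (Y k) P := by
  have h := hi.indepFun_finset (Finset.range k) {k} (by simp) hm
  let φ : (Finset.range k → ℝ) → ℝ := fun u =>
    runMax (fun j => ∑ i ∈ Finset.range j, if h : i ∈ Finset.range k then u ⟨i, h⟩ else 0) k
  have hφ : Measurable φ := by
    refine measurable_runMax (fun j => Finset.measurable_sum _ fun i _ => ?_) k
    split_ifs
    · exact measurable_pi_apply _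
    · exact measurable_const
  have h2 := h.comp hφ (measurable_pi_apply (⟨k, by simp⟩ : ({k} : Finset ℕ)))
  refine IndepFun.congr h2 (.of_forall fun ω => ?_) (.of_forall fun ω => rfl)
  refine runMax_congr fun j hj => Finset.sum_congr rfl fun i hij => ?_
  have : i ∈ Finset.range k := by
    rw [Finset.mem_range] at hij ⊢
    omega
  simp only [this, dite_true]

variable [IsProbabilityMeasure P]

theorem integrable_of_abs_le {f : Ω → ℝ} (hf : Measurable f) {K : ℝ}
    (h : ∀ᵐ ω ∂P, |f ω| ≤ K) : Integrable f P :=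
  Integrable.of_bound hf.aestronglyMeasurable K h

theorem integral_sq_sum_le (hm : ∀ i, Measurable (Y i)) (hi : iIndepFun Y P)
    (hb : ∀ i, ∀ᵐ ω ∂P, |Y i ω| ≤ R) (h0 : ∀ i, ∫ ω, Y i ω ∂P = 0) (n : ℕ) :
    ∫ ω, (∑ i ∈ Finset.range n, Y i ω) ^ 2 ∂P ≤ n * R ^ 2 := by
  induction n with
  | zero => simp
  | succ n ih =>
    have hZm : Measurable fun ω => ∑ i ∈ Finset.range n, Y i ω :=
      Finset.measurable_sum _ fun i _ => hm i
    have hind : IndepFun (fun ω => ∑ i ∈ Finset.range n, Y i ω) (Y n) P := by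
      have := hi.indepFun_finsetSum_of_notMem hm (s := Finset.range n) (i := n) (by simp)
      convert this using 1
      ext ω; simp
    have hcross : ∫ ω, (∑ i ∈ Finset.range n, Y i ω) * Y n ω ∂P = 0 := by
      rw [hind.integral_fun_mul_eq_mul_integral hZm.aestronglyMeasurable
        (hm n).aestronglyMeasurable, h0, mul_zero]
    have hZ := ae_abs_sum_le hb
    have i1 : Integrable (fun ω => (∑ i ∈ Finset.range n, Y i ω) ^ 2) P := by
      refine integrable_of_abs_le (hZm.pow_const 2) (K := (n * R) ^ 2) ?_
      filter_upwards [hZ] with ω hω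
      rw [abs_pow]
      exact pow_le_pow_left₀ (abs_nonneg _) (hω n) 2
    have i2 : Integrable (fun ω => (∑ i ∈ Finset.range n, Y i ω) * Y n ω) P := by
      refine integrable_of_abs_le (hZm.mul (hm n)) (K := (n * R) * R) ?_
      filter_upwards [hZ, hb n] with ω hω hn
      rw [abs_mul]
      exact mul_le_mul (hω n) hn (abs_nonneg _) ((abs_nonneg _).trans (hω n))
    have i3 : Integrable (fun ω => Y n ω ^ 2) P := by
      refine integrable_of_abs_le ((hm n).pow_const 2) (K := R ^ 2) ?_
      filter_upwards [hb n] with ω hn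
      rw [abs_pow]
      exact pow_le_pow_left₀ (abs_nonneg _) hn 2
    have h3 : ∫ ω, Y n ω ^ 2 ∂P ≤ R ^ 2 := by
      have := integral_mono_ae i3 (integrable_const (R ^ 2)) (by
        filter_upwards [hb n] with ω hn
        exact sq_le_sq' (abs_le.mp hn).1 (abs_le.mp hn).2)
      simpa using this
    have heq : ∀ ω, (∑ i ∈ Finset.range (n + 1), Y i ω) ^ 2 =
        (∑ i ∈ Finset.range n, Y i ω) ^ 2 + 2 * ((∑ i ∈ Finset.range n, Y i ω) * Y n ω) +
          Y n ω ^ 2 := by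
      intro ω; rw [Finset.sum_range_succ]; ring
    simp only [heq]
    have i12 : Integrable (fun ω => (∑ i ∈ Finset.range n, Y i ω) ^ 2 +
        2 * ((∑ i ∈ Finset.range n, Y i ω) * Y n ω)) P := i1.add (i2.const_mul 2)
    rw [integral_add i12 i3, integral_add i1 (i2.const_mul 2), integral_const_mul, hcross]
    push_cast
    linarith

/-- The expected maximum of the partial sums of `n` bounded centred independent variables is of
the order of `√n`. -/
theorem integral_runMax_le (hm : ∀ i, Measurable (Y i)) (hi : iIndepFun Y P) (hR : 0 ≤ R)
    (hb : ∀ i, ∀ᵐ ω ∂P, |Y i ω| ≤ R) (h0 : ∀ i, ∫ ω, Y i ω ∂P = 0) {n : ℕ} (hn : 1 ≤ n) :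
    Integrable (fun ω => runMax (fun j => ∑ i ∈ Finset.range j, Y i ω) n) P ∧
    ∫ ω, runMax (fun j => ∑ i ∈ Finset.range j, Y i ω) n ∂P ≤
      (4 * R ^ 2 + 1) * (n : ℝ) ^ (1 / 2 : ℝ) := by
  have hZm : ∀ j, Measurable fun ω => ∑ i ∈ Finset.range j, Y i ω := fun j =>
    Finset.measurable_sum _ fun i _ => hm i
  have hMm := measurable_runMax hZm
  have hZ := ae_abs_sum_le hb
  have hMb : ∀ᵐ ω ∂P, ∀ k, |runMax (fun j => ∑ i ∈ Finset.range j, Y i ω) k| ≤ k * R := by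
    filter_upwards [hZ] with ω hω k
    rw [abs_of_nonneg (runMax_nonneg _ _)]
    refine runMax_le _ (by positivity) fun j hj => (le_abs_self _).trans ((hω j).trans ?_)
    gcongr
  have hMi : Integrable (fun ω => runMax (fun j => ∑ i ∈ Finset.range j, Y i ω) n) P :=
    integrable_of_abs_le (hMm n) (hMb.mono fun ω h => h n)
  refine ⟨hMi, ?_⟩
  have i1 : Integrable (fun ω => (∑ i ∈ Finset.range n, Y i ω) ^ 2) P := by
    refine integrable_of_abs_le ((hZm n).pow_const 2) (K := (n * R) ^ 2) ?_
    filter_upwards [hZ] with ω hω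
    rw [abs_pow]
    exact pow_le_pow_left₀ (abs_nonneg _) (hω n) 2
  have i2 : Integrable (fun ω => runMax (fun j => ∑ i ∈ Finset.range j, Y i ω) n ^ 2) P := by
    refine integrable_of_abs_le ((hMm n).pow_const 2) (K := (n * R) ^ 2) ?_
    filter_upwards [hMb] with ω hω
    rw [abs_pow]
    exact pow_le_pow_left₀ (abs_nonneg _) (hω n) 2
  have i3 : ∀ k, Integrable
      (fun ω => runMax (fun j => ∑ i ∈ Finset.range j, Y i ω) k * Y k ω) P := by
    intro k
    refine integrable_of_abs_le ((hMm k).mul (hm k)) (K := (k * R) * R) ?_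
    filter_upwards [hMb, hb k] with ω hω hk
    rw [abs_mul]
    exact mul_le_mul (hω k) hk (abs_nonneg _) ((abs_nonneg _).trans (hω k))
  have hcross : ∀ k, ∫ ω, runMax (fun j => ∑ i ∈ Finset.range j, Y i ω) k * Y k ω ∂P = 0 := by
    intro k
    rw [(indepFun_runMax hm hi k).integral_fun_mul_eq_mul_integral (hMm k).aestronglyMeasurable
      (hm k).aestronglyMeasurable, h0, mul_zero]
  have hsq : ∫ ω, runMax (fun j => ∑ i ∈ Finset.range j, Y i ω) n ^ 2 ∂P ≤ 4 * (n * R ^ 2) := by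
    have i4 := (i1.const_mul 4).sub ((integrable_finsetSum (Finset.range n)
      fun k _ => i3 k).const_mul 4)
    have h := integral_mono i2 i4 fun ω => by
      have := runMax_sq_le (fun j => ∑ i ∈ Finset.range j, Y i ω) n
      simpa [Finset.sum_range_succ] using this
    refine h.trans ?_
    simp only [Pi.sub_apply]
    rw [integral_sub (i1.const_mul 4) ((integrable_finsetSum (Finset.range n)
      fun k _ => i3 k).const_mul 4), integral_const_mul, integral_const_mul,
      integral_finsetSum _ fun k _ => i3 k]
    simp only [hcross, Finset.sum_const_zero]
    linarith [integral_sq_sum_le hm hi hb h0 n]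
  set y := (n : ℝ) ^ (1 / 2 : ℝ) with hy
  have hn' : (0 : ℝ) < n := by exact_mod_cast hn
  have hy0 : 0 < y := by positivity
  have hyy : y * y = n := by
    rw [hy, ← Real.rpow_add hn']; norm_num
  -- From second to first moment by `m ≤ m ^ 2 / y + y` with `y = √n`.
  have h := integral_mono hMi ((i2.div_const y).add (integrable_const y)) fun ω => by
    change _ ≤ _ / y + y
    set m := runMax (fun j => ∑ i ∈ Finset.range j, Y i ω) n
    rw [← sub_le_iff_le_add, le_div_iff₀ hy0]
    nlinarith [sq_nonneg (m - y)]
  refine h.trans ?_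
  simp only [Pi.add_apply]
  rw [integral_add (i2.div_const y) (integrable_const y), integral_div]
  have h2 : (∫ ω, runMax (fun j => ∑ i ∈ Finset.range j, Y i ω) n ^ 2 ∂P) / y ≤ 4 * R ^ 2 * y := by
    rw [div_le_iff₀ hy0, mul_assoc, hyy]
    linarith
  simp only [integral_const, probReal_univ, smul_eq_mul, one_mul]
  linarith

/-- Hoeffding's inequality for both tails; at scale `√j` the bound does not depend on `j`, as the
union bound over prefix lengths requires. -/
theorem measureReal_abs_sum_gt_le (hm : ∀ i, Measurable (Y i)) (hi : iIndepFun Y P) (hR : 0 < R)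
    (hb : ∀ i, ∀ᵐ ω ∂P, |Y i ω| ≤ R) (h0 : ∀ i, ∫ ω, Y i ω ∂P = 0) {κ : ℝ} (hκ : 0 ≤ κ) (j : ℕ) :
    P.real {ω | κ * (j : ℝ) ^ (1 / 2 : ℝ) < |∑ i ∈ Finset.range j, Y i ω|} ≤
      2 * Real.exp (-(κ ^ 2 / (2 * R ^ 2))) := by
  rcases Nat.eq_zero_or_pos j with rfl | hj
  · simp; positivity
  have hj' : (0 : ℝ) < j := by exact_mod_cast hj
  have hsub : ∀ i, HasSubgaussianMGF (Y i) ((‖R - -R‖₊ / 2) ^ 2) P := fun i =>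
    hasSubgaussianMGF_of_mem_Icc_of_integral_eq_zero (hm i).aemeasurable
      ((hb i).mono fun ω h => abs_le.mp h) (h0 i)
  have hc : (((‖R - -R‖₊ / 2) ^ 2 : NNReal) : ℝ) = R ^ 2 := by
    push_cast
    rw [Real.norm_eq_abs, abs_of_pos (by linarith)]
    ring
  have hε : 0 ≤ κ * (j : ℝ) ^ (1 / 2 : ℝ) := by positivity
  have h1 := HasSubgaussianMGF.measure_sum_range_ge_le_of_iIndepFun hi (n := j)
    (fun i _ => hsub i) hε
  have hi' : iIndepFun (fun i ω => - Y i ω) P := hi.comp (fun _ y => -y) fun _ => measurable_neg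
  have h2 := HasSubgaussianMGF.measure_sum_range_ge_le_of_iIndepFun hi' (n := j)
    (fun i _ => (hsub i).neg) hε
  have hexp : -(κ * (j : ℝ) ^ (1 / 2 : ℝ)) ^ 2 / (2 * j * (((‖R - -R‖₊ / 2) ^ 2 : NNReal) : ℝ)) =
      -(κ ^ 2 / (2 * R ^ 2)) := by
    rw [hc, mul_pow, ← Real.rpow_natCast ((j : ℝ) ^ (1 / 2 : ℝ)), ← Real.rpow_mul hj'.le]
    norm_num
    field_simp
  rw [hexp] at h1 h2
  have h3 : {ω | κ * (j : ℝ) ^ (1 / 2 : ℝ) < |∑ i ∈ Finset.range j, Y i ω|} ⊆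
      {ω | κ * (j : ℝ) ^ (1 / 2 : ℝ) ≤ ∑ i ∈ Finset.range j, Y i ω} ∪
      {ω | κ * (j : ℝ) ^ (1 / 2 : ℝ) ≤ ∑ i ∈ Finset.range j, - Y i ω} := by
    intro ω hω
    rw [Set.mem_ofPred_eq, lt_abs] at hω
    rcases hω with h | h
    · exact Or.inl h.le
    · right
      rw [Set.mem_ofPred_eq, Finset.sum_neg_distrib]
      exact h.le
  have h4 := (measureReal_mono h3 (μ := P)).trans (measureReal_union_le _ _)
  linarith

end Independent

/-- The total cost of the bad events: `n` is the size of the trivial error and `n + 1` the number of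
prefix lengths. One term of the exponential series, of order `m ≥ 1/δ`, already beats the product.
-/
theorem exists_mul_exp_neg_le {c δ : ℝ} (hc : 0 < c) (hδ : 0 < δ) :
    ∃ K : ℝ, 0 ≤ K ∧ ∀ n : ℕ, 1 ≤ n →
      (n : ℝ) * (n + 1) * Real.exp (-(((n : ℝ) ^ δ) ^ 2 / c)) ≤ K := by
  obtain ⟨m, hm⟩ := exists_nat_ge (1 / δ)
  refine ⟨2 * (m.factorial : ℝ) * c ^ m, by positivity, fun n hn => ?_⟩
  have hn1 : (1 : ℝ) ≤ n := by exact_mod_cast hn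
  have hn0 : (0 : ℝ) < n := by linarith
  set y := ((n : ℝ) ^ δ) ^ 2 / c with hy
  have hy0 : 0 < y := by positivity
  have h1 := Real.pow_div_factorial_le_exp y hy0.le m
  have h2 : (n : ℝ) ^ 2 / c ^ m ≤ y ^ m := by
    rw [hy, div_pow]
    gcongr
    rw [← pow_mul, mul_comm 2 m, pow_mul, ← Real.rpow_natCast ((n : ℝ) ^ δ) m,
      ← Real.rpow_mul hn0.le]
    gcongr
    calc (n : ℝ) = (n : ℝ) ^ (1 : ℝ) := (Real.rpow_one _).symm
      _ ≤ _ := Real.rpow_le_rpow_of_exponent_le hn1 (by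
        rw [div_le_iff₀ hδ] at hm
        linarith)
  have hf : (0 : ℝ) < m.factorial := by positivity
  have h3 : (n : ℝ) ^ 2 ≤ m.factorial * c ^ m * Real.exp y := by
    have h4 : (n : ℝ) ^ 2 / c ^ m / m.factorial ≤ Real.exp y :=
      (div_le_div_of_nonneg_right h2 hf.le).trans h1
    rw [div_div, div_le_iff₀ (by positivity)] at h4
    linarith
  rw [Real.exp_neg, ← div_eq_mul_inv, div_le_iff₀ (Real.exp_pos _)]
  nlinarith

end MCTS

namespace MCTS

/-! ### Measurability of the statistics. -/

section Measurability

variable {S A : Type*} {Ω : Type*} [MeasurableSpace Ω]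

/-- Statistics all of whose entries are random variables. -/
structure MeasurableStats (st : Ω → Stats A) : Prop where
  N : ∀ p, Measurable fun ω => (st ω).N p
  v : ∀ p, Measurable fun ω => (st ω).v p
  q : ∀ p a, Measurable fun ω => (st ω).q p a

variable {st : Ω → Stats A}

theorem MeasurableStats.index (hst : MeasurableStats st) (c : Params)
    (γ : ℝ) (p : List A) (a : A) :
    Measurable fun ω => MCTS.index γ c (st ω) p a := by
  simp only [MCTS.index]
  refine Measurable.ite (hst.N _ (measurableSet_singleton 0)) measurable_const ?_
  refine measurable_coe_real_ereal.comp ?_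
  have hN : ∀ p, Measurable fun ω => ((st ω).N p : ℝ) := fun p =>
    (measurable_of_countable (fun k : ℕ => (k : ℝ))).comp (hst.N p)
  refine (((hst.q p a).add ((hst.v _).const_mul γ)).div (hN _)).add ?_
  exact (((hN p).pow_const _).const_mul _).div ((hN _).pow_const _)

/-- The sample is read at a random index, but the index set is countable. -/
theorem MeasurableStats.received (hst : MeasurableStats st) {X : List A → A → ℕ → Ω → ℝ}
    (hX : ∀ p a j, Measurable (X p a j))
    (p : List A) (a : A) :
    Measurable fun ω => MCTS.received (fun p a j => X p a j ω) (st ω) p a := by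
  have h : Measurable fun z : ℕ × Ω => X p a z.1 z.2 :=
    measurable_from_prod_countable_right fun j => hX p a j
  exact h.comp ((hst.N (a :: p)).prodMk measurable_id)

variable [Fintype A]

theorem MeasurableStats.argmaxIndex (hst : MeasurableStats st) (c : Params)
    (γ : ℝ) (p : List A) (B : Finset A) :
    MeasurableSet {ω | MCTS.argmaxIndex γ c (st ω) p = B} := by
  have : {ω | MCTS.argmaxIndex γ c (st ω) p = B} =
      ⋂ a, {ω | (∀ b, MCTS.index γ c (st ω) p b ≤ MCTS.index γ c (st ω) p a) ↔ a ∈ B} := by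
    ext ω
    simp [MCTS.argmaxIndex, Finset.ext_iff]
  rw [this]
  refine MeasurableSet.iInter fun a => ?_
  refine MeasurableSet.iff ?_ (MeasurableSet.const _)
  have h2 : {ω | ∀ b, MCTS.index γ c (st ω) p b ≤ MCTS.index γ c (st ω) p a} =
      ⋂ b, {ω | MCTS.index γ c (st ω) p b ≤ MCTS.index γ c (st ω) p a} := by
    ext ω; simp
  rw [h2]
  exact MeasurableSet.iInter fun b => measurableSet_le (hst.index c γ p b) (hst.index c γ p a)

theorem MeasurableStats.select (hst : MeasurableStats st) (M : MDP S A) (c : Params)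
    {tie : Ω → TieRule A} (htie : IsTieRule tie)
    (t : ℕ) (p : List A) (a : A) :
    MeasurableSet {ω | MCTS.select M c (tie ω) (st ω) t p = a} := by
  have : {ω | MCTS.select M c (tie ω) (st ω) t p = a} =
      ⋃ B : Finset A, {ω | MCTS.argmaxIndex M.γ c (st ω) p = B} ∩ {ω | tie ω t p B = a} := by
    ext ω
    simp [MCTS.select]
  rw [this]
  exact MeasurableSet.iUnion fun B => (hst.argmaxIndex c M.γ p B).inter (htie.meas t p B a)

theorem MeasurableStats.leaf (hst : MeasurableStats st) (M : MDP S A) (c : Params)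
    {tie : Ω → TieRule A} (htie : IsTieRule tie)
    (t k : ℕ) (p l : List A) :
    MeasurableSet {ω | MCTS.leaf M c (tie ω) (st ω) t k p = l} := by
  induction k generalizing p with
  | zero => exact MeasurableSet.const (p = l)
  | succ k ih =>
    have : {ω | MCTS.leaf M c (tie ω) (st ω) t (k + 1) p = l} =
        ⋃ a, {ω | MCTS.select M c (tie ω) (st ω) t p = a} ∩
          {ω | MCTS.leaf M c (tie ω) (st ω) t k (a :: p) = l} := by
      ext ω
      simp [MCTS.leaf]
    rw [this]
    exact MeasurableSet.iUnion fun a => (hst.select M c htie t p a).inter (ih _)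

theorem MeasurableStats.suffix_leaf (hst : MeasurableStats st) (M : MDP S A) (c : Params)
    {tie : Ω → TieRule A} (htie : IsTieRule tie)
    (t k : ℕ) (p r : List A) :
    MeasurableSet {ω | r <:+ MCTS.leaf M c (tie ω) (st ω) t k p} := by
  have : {ω | r <:+ MCTS.leaf M c (tie ω) (st ω) t k p} =
      ⋃ l ∈ {l : List A | r <:+ l}, {ω | MCTS.leaf M c (tie ω) (st ω) t k p = l} := by
    ext ω
    simp
  rw [this]
  exact MeasurableSet.biUnion (Set.to_countable _) fun l _ => hst.leaf M c htie t k p l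

theorem MeasurableStats.ret (hst : MeasurableStats st) (M : MDP S A) (Vhat : S → ℝ) (s : S) (c : Params)
    {tie : Ω → TieRule A} (htie : IsTieRule tie) {X : List A → A → ℕ → Ω → ℝ}
    (hX : ∀ p a j, Measurable (X p a j))
    (t k : ℕ) (p : List A) :
    Measurable fun ω =>
      MCTS.ret M Vhat s c (tie ω) (fun p a j => X p a j ω) (st ω) t k p := by
  induction k generalizing p with
  | zero => exact measurable_const
  | succ k ih =>
    have : (fun ω => MCTS.ret M Vhat s c (tie ω) (fun p a j => X p a j ω) (st ω) t (k + 1) p) =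
        fun ω => ∑ a, if MCTS.select M c (tie ω) (st ω) t p = a then
          MCTS.received (fun p a j => X p a j ω) (st ω) p a +
            M.γ * MCTS.ret M Vhat s c (tie ω) (fun p a j => X p a j ω) (st ω) t k (a :: p)
          else 0 := by
      ext ω
      simp [MCTS.ret]
    rw [this]
    refine Finset.measurable_sum _ fun a _ => Measurable.ite (hst.select M c htie t p a) ?_
      measurable_const
    exact (hst.received hX p a).add ((ih _).const_mul _)

theorem MeasurableStats.step (hst : MeasurableStats st) (M : MDP S A) (Vhat : S → ℝ) (s : S) (c : Params)
    {tie : Ω → TieRule A} (htie : IsTieRule tie) {X : List A → A → ℕ → Ω → ℝ}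
    (hX : ∀ p a j, Measurable (X p a j))
    (H t : ℕ) :
    MeasurableStats fun ω =>
      MCTS.step M Vhat s c (tie ω) (fun p a j => X p a j ω) H (st ω) t where
  N p := Measurable.ite (hst.suffix_leaf M c htie t H [] p) ((hst.N p).add_const 1) (hst.N p)
  v p := Measurable.ite (hst.suffix_leaf M c htie t H [] p)
    ((hst.v p).add (hst.ret M Vhat s c htie hX t _ p)) (hst.v p)
  q p a := Measurable.ite (hst.suffix_leaf M c htie t H [] (a :: p))
    ((hst.q p a).add (hst.received hX p a)) (hst.q p a)

theorem measurableStats_run (M : MDP S A) (Vhat : S → ℝ) (s : S) (c : Params)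
    {tie : Ω → TieRule A} (htie : IsTieRule tie) {X : List A → A → ℕ → Ω → ℝ}
    (hX : ∀ p a j, Measurable (X p a j))
    (H t : ℕ) :
    MeasurableStats fun ω => run M Vhat s c (tie ω) (fun p a j => X p a j ω) H t := by
  induction t with
  | zero => exact ⟨fun _ => measurable_const, fun _ => measurable_const, fun _ _ => measurable_const⟩
  | succ t ih => exact ih.step M Vhat s c htie hX H (t + 1)

end Measurability

section Bounds

variable {S A : Type*} [Fintype A] (M : MDP S A) (Vhat : S → ℝ) (s : S) (c : Params)
  (tie : TieRule A) (x : List A → A → ℕ → ℝ) (H : ℕ)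

/-- Serves both the integrability of the output and the trivial error bound on the bad events. -/
theorem abs_run_v_le {R B : ℝ} (hx : ∀ p a j, |x p a j| ≤ R) (hB : ∀ s, |Vhat s| ≤ B)
    (t k : ℕ) (p : List A) (hp : p.length + k = H) :
    |(run M Vhat s c tie x H t).v p| ≤ (run M Vhat s c tie x H t).N p * (k * R + B) := by
  induction k generalizing p with
  | zero =>
    rw [run_v_leaf M Vhat s c tie x H t p (by omega), abs_mul, Nat.abs_cast]
    have := hB (M.stateAt s p)
    simp only [Nat.cast_zero, zero_mul, zero_add]
    gcongr
  | succ k ih =>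
    rw [run_v_eq_sum M Vhat s c tie x H t p (by omega),
      run_N_eq_sum M Vhat s c tie x H t p (by omega)]
    push_cast
    rw [Finset.sum_mul]
    refine (Finset.abs_sum_le_sum_abs _ _).trans (Finset.sum_le_sum fun a _ => ?_)
    have h1 := ih (a :: p) (by rw [List.length_cons]; omega)
    have h2 : |(run M Vhat s c tie x H t).q p a| ≤ (run M Vhat s c tie x H t).N (a :: p) * R := by
      rw [run_q_eq_sum]
      refine (Finset.abs_sum_le_sum_abs _ _).trans ?_
      simpa using Finset.sum_le_card_nsmul
        (Finset.range ((run M Vhat s c tie x H t).N (a :: p))) (fun i => |x p a i|) R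
        fun i _ => hx p a i
    refine (abs_add_le _ _).trans ?_
    rw [abs_mul, abs_of_pos M.γ_pos]
    have h3 := mul_le_of_le_one_left (abs_nonneg ((run M Vhat s c tie x H t).v (a :: p)))
      M.γ_lt_one.le
    linarith

end Bounds

/-! ### Centred reward samples. -/

namespace IsRewardSample

variable {S A : Type*} {M : MDP S A} {s : S} {Ω : Type*} [MeasurableSpace Ω]
  {P : Measure Ω} {X : List A → A → ℕ → Ω → ℝ}

theorem ae_abs_le (hX : IsRewardSample M s P X) (p : List A) (a : A) (j : ℕ) : ∀ᵐ ω ∂P, |X p a j ω| ≤ M.Rmax := by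
  have h := M.reward_bdd (M.stateAt s p) a
  rw [← hX.law p a j] at h
  filter_upwards [ae_of_ae_map (hX.meas p a j).aemeasurable h] with ω hω
  exact abs_le.mpr hω

theorem integral_eq (hX : IsRewardSample M s P X) (p : List A) (a : A) (j : ℕ) :
    ∫ ω, X p a j ω ∂P = M.mean (M.stateAt s p) a := by
  rw [MDP.mean, ← hX.law p a j]
  exact (integral_map (hX.meas p a j).aemeasurable aestronglyMeasurable_id).symm

theorem centred_indep (hX : IsRewardSample M s P X) (p : List A) (a : A) :
    iIndepFun (fun j ω => X p a j ω - M.mean (M.stateAt s p) a) P := by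
  have h := hX.indep.precomp (g := fun j : ℕ => (p, a, j)) fun i j h => by simpa using h
  exact h.comp (fun _ y => y - M.mean (M.stateAt s p) a) fun _ => measurable_id.sub_const _

theorem centred_bound (hX : IsRewardSample M s P X) (p : List A) (a : A) (j : ℕ) :
    ∀ᵐ ω ∂P, |X p a j ω - M.mean (M.stateAt s p) a| ≤ 2 * M.Rmax := by
  filter_upwards [hX.ae_abs_le p a j] with ω hω
  have := M.abs_mean_le (M.stateAt s p) a
  refine (abs_sub _ _).trans ?_
  linarith

theorem centred_integral [IsProbabilityMeasure P] (hX : IsRewardSample M s P X) (p : List A) (a : A) (j : ℕ) :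
    ∫ ω, X p a j ω - M.mean (M.stateAt s p) a ∂P = 0 := by
  rw [integral_sub (integrable_of_abs_le (hX.meas p a j) (hX.ae_abs_le p a j))
    (integrable_const _), hX.integral_eq]
  simp

end IsRewardSample

/-! ### Mean error of the output. -/

section Final

variable {S A : Type*} [Fintype A] [Nonempty A] (M : MDP S A) (Vhat : S → ℝ) (s : S) (c : Params)
  (H : ℕ)

/-- The output of the search approximates the `H`-fold Bellman iterate of the value oracle in mean,
at the rate `n ^ (η - 1)`. -/
theorem exists_integral_abs_output_sub_le (hV : ∃ B : ℝ, ∀ s, |Vhat s| ≤ B)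
    {η : ℝ} (hη : 1 / 2 ≤ η) (hη1 : η < 1) (hcη : ∀ h, c.η h = η)
    (hcα : ∀ h, 1 ≤ h → h ≤ H → c.α h / c.ξ h = η * (1 - η))
    (hcβ : ∀ h, 1 ≤ h → h ≤ H → 1 ≤ c.β h ^ (1 / c.ξ h)) :
    ∃ C : ℝ, ∀ (Ω : Type*) [MeasurableSpace Ω] (P : Measure Ω) [IsProbabilityMeasure P]
      (X : List A → A → ℕ → Ω → ℝ) (tie : Ω → TieRule A),
      IsRewardSample M s P X → IsTieRule tie → ∀ n : ℕ, 1 ≤ n →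
      Integrable (fun ω => output M Vhat s c (tie ω) (fun p a j => X p a j ω) H n) P ∧
      ∫ ω, |output M Vhat s c (tie ω) (fun p a j => X p a j ω) H n - M.bellmanIter Vhat H s| ∂P ≤
        C * (n : ℝ) ^ (η - 1) := by
  have hη0 : 0 < η := by linarith
  obtain ⟨B, hB⟩ := hV
  have hB0 : 0 ≤ B := (abs_nonneg _).trans (hB s)
  have hR := M.Rmax_pos
  obtain ⟨C, e, hC, he, hmain⟩ :=
    node_error_bounds M Vhat s c H hη hη1 hcη hcα hcβ H [] (by simp)
  -- Small enough for `κ ^ e = n ^ (δ * e) ≤ n ^ η`; the `+ 1` allows `e = 0`.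
  set δ := η / (e + 1) with hδ
  have hδ0 : 0 < δ := by positivity
  have hδe : δ * e ≤ η := by
    rw [hδ, div_mul_eq_mul_div, div_le_iff₀ (by linarith)]
    nlinarith
  obtain ⟨K, hK, hKn⟩ := exists_mul_exp_neg_le (c := 2 * (2 * M.Rmax) ^ 2) (by positivity) hδ0
  set E : Finset (List A × A) := (List.finite_length_lt A H).toFinset ×ˢ Finset.univ with hE
  have hEmem : ∀ p : List A, p.length < H → ∀ a, (p, a) ∈ E := fun p hp a => by simp [hE, hp]
  set W := M.bellmanIter Vhat H s with hW
  set Q := H * M.Rmax + B + |W| with hQ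
  have hQ0 : 0 ≤ Q := by positivity
  set D := 4 * (2 * M.Rmax) ^ 2 + 1 with hD
  have hD0 : 0 ≤ D := by positivity
  refine ⟨C * (E.card * (2 * D) + 2) + Q * (E.card * (2 * K)), ?_⟩
  intro Ω _ P _ X tie hX htie n hn
  have hn1 : (1 : ℝ) ≤ n := by exact_mod_cast hn
  have hn0 : (0 : ℝ) < n := by linarith
  set κ := (n : ℝ) ^ δ with hκ
  have hκ1 : 1 ≤ κ := Real.one_le_rpow hn1 hδ0.le
  set V : Ω → ℝ := fun ω => (run M Vhat s c (tie ω) (fun p a j => X p a j ω) H n).v [] with hVdef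
  have hVm : Measurable V := (measurableStats_run M Vhat s c htie hX.meas H n).v []
  have hVb : ∀ᵐ ω ∂P, |V ω| ≤ n * (H * M.Rmax + B) := by
    have : Countable A := Finite.to_countable
    have h : ∀ᵐ ω ∂P, ∀ p a j, |X p a j ω| ≤ M.Rmax := by
      simp only [ae_all_iff]
      exact fun p a j => hX.ae_abs_le p a j
    filter_upwards [h] with ω hω
    have := abs_run_v_le M Vhat s c (tie ω) (fun p a j => X p a j ω) H hω hB n H []
      (by simp)
    rwa [run_N_root] at this
  have hVi : Integrable V P := integrable_of_abs_le hVm hVb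
  refine ⟨hVi.div_const _, ?_⟩
  set Y : List A × A → ℕ → Ω → ℝ := fun d j ω => X d.1 d.2 j ω - M.mean (M.stateAt s d.1) d.2
    with hY
  set Z : List A × A → ℕ → Ω → ℝ := fun d j ω => ∑ i ∈ Finset.range j, Y d i ω with hZ
  have hYm : ∀ d j, Measurable (Y d j) := fun d j => (hX.meas _ _ _).sub_const _
  have hZm : ∀ d j, Measurable (Z d j) := fun d j => Finset.measurable_sum _ fun i _ => hYm d i
  have hZeq : ∀ d j ω, Z d j ω =
      ∑ i ∈ Finset.range j, X d.1 d.2 i ω - j * M.mean (M.stateAt s d.1) d.2 := by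
    intro d j ω
    simp [hZ, hY, Finset.sum_sub_distrib]
  -- Running maxima of the sums and of their negatives. Both are nonnegative, so their sum dominates
  -- `|Z d j|` for all `j ≤ n`.
  set F : List A × A → Ω → ℝ := fun d ω =>
    runMax (fun j => ∑ i ∈ Finset.range j, Y d i ω) n +
      runMax (fun j => ∑ i ∈ Finset.range j, -Y d i ω) n with hF
  have hFi : ∀ d, Integrable (F d) P ∧ ∫ ω, F d ω ∂P ≤ 2 * D * (n : ℝ) ^ (1 / 2 : ℝ) := by
    intro d
    have h1 := integral_runMax_le (hYm d) (hX.centred_indep d.1 d.2) (by positivity)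
      (hX.centred_bound d.1 d.2) (hX.centred_integral d.1 d.2) hn
    have h2 := integral_runMax_le (Y := fun i ω => -Y d i ω) (fun i => (hYm d i).neg)
      ((hX.centred_indep d.1 d.2).comp (fun _ y => -y) fun _ => measurable_neg)
      (R := 2 * M.Rmax) (by positivity)
      (fun i => by simpa only [abs_neg] using hX.centred_bound d.1 d.2 i)
      (fun i => by rw [integral_neg, hX.centred_integral d.1 d.2 i, neg_zero]) hn
    refine ⟨h1.1.add h2.1, ?_⟩
    rw [hF]
    simp only
    rw [integral_add h1.1 h2.1]
    linarith [h1.2, h2.2]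
  have hF0 : ∀ d ω, 0 ≤ F d ω := fun d ω => add_nonneg (runMax_nonneg _ _) (runMax_nonneg _ _)
  have hZF : ∀ d ω, ∀ j ≤ n, |Z d j ω| ≤ F d ω := by
    intro d ω j hj
    have h1 := le_runMax (fun j => ∑ i ∈ Finset.range j, Y d i ω) (by simp) hj
    have h2 := le_runMax (fun j => ∑ i ∈ Finset.range j, -Y d i ω) (by simp) hj
    have h3 := runMax_nonneg (fun j => ∑ i ∈ Finset.range j, Y d i ω) n
    have h4 := runMax_nonneg (fun j => ∑ i ∈ Finset.range j, -Y d i ω) n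
    simp only [Finset.sum_neg_distrib] at h2 h4
    simp only [hF, hZ, Finset.sum_neg_distrib]
    exact abs_le.mpr ⟨by linarith, by linarith⟩
  set bad : List A × A → ℕ → Set Ω := fun d j => {ω | κ * (j : ℝ) ^ (1 / 2 : ℝ) < |Z d j ω|}
    with hbad
  have hbadm : ∀ d j, MeasurableSet (bad d j) := fun d j =>
    measurableSet_lt measurable_const (hZm d j).abs
  have hbadP : ∀ d j, P.real (bad d j) ≤ 2 * Real.exp (-(κ ^ 2 / (2 * (2 * M.Rmax) ^ 2))) :=
    fun d j => measureReal_abs_sum_gt_le (hYm d) (hX.centred_indep d.1 d.2) (by positivity)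
      (hX.centred_bound d.1 d.2) (hX.centred_integral d.1 d.2) (by linarith) j
  have hκe : κ ^ e ≤ (n : ℝ) ^ η := by
    rw [hκ, ← Real.rpow_mul hn0.le]
    exact Real.rpow_le_rpow_of_exponent_le hn1 hδe
  have hnη : (1 : ℝ) ≤ (n : ℝ) ^ η := Real.one_le_rpow hn1 hη0.le
  -- Good and bad outcomes in one inequality: if some deviation bound fails, the sum of indicators
  -- is at least `1` and pays for the trivial error `n * Q`.
  have hpt : ∀ᵐ ω ∂P, |V ω - n * W| ≤ C * (∑ d ∈ E, F d ω + 2 * (n : ℝ) ^ η) +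
      n * Q * ∑ d ∈ E, ∑ j ∈ Finset.range (n + 1), (bad d j).indicator (fun _ => (1 : ℝ)) ω := by
    filter_upwards [hVb] with ω hω
    have hind : ∀ d j, 0 ≤ (bad d j).indicator (fun _ => (1 : ℝ)) ω := fun d j =>
      Set.indicator_nonneg (fun _ _ => zero_le_one) _
    have hFs : 0 ≤ ∑ d ∈ E, F d ω := Finset.sum_nonneg fun d _ => hF0 d ω
    by_cases hg : ∃ d ∈ E, ∃ j ≤ n, ω ∈ bad d j
    · obtain ⟨d, hd, j, hj, hb⟩ := hg
      have h1 : 1 ≤ ∑ d ∈ E, ∑ j ∈ Finset.range (n + 1),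
          (bad d j).indicator (fun _ => (1 : ℝ)) ω := by
        calc (1 : ℝ) = (bad d j).indicator (fun _ => (1 : ℝ)) ω := by
              rw [Set.indicator_of_mem hb]
          _ ≤ ∑ j ∈ Finset.range (n + 1), (bad d j).indicator (fun _ => (1 : ℝ)) ω :=
              Finset.single_le_sum (fun j _ => hind d j) (Finset.mem_range.mpr (by omega))
          _ ≤ _ := Finset.single_le_sum (f := fun d => ∑ j ∈ Finset.range (n + 1),
              (bad d j).indicator (fun _ => (1 : ℝ)) ω)
              (fun d _ => Finset.sum_nonneg fun j _ => hind d j) hd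
      have h2 : |V ω - n * W| ≤ n * Q := by
        refine (abs_sub _ _).trans ?_
        rw [abs_mul, Nat.abs_cast, hQ]
        linarith
      have h3 : n * Q * 1 ≤ n * Q * ∑ d ∈ E, ∑ j ∈ Finset.range (n + 1),
          (bad d j).indicator (fun _ => (1 : ℝ)) ω := by gcongr
      have h4 : 0 ≤ C * (∑ d ∈ E, F d ω + 2 * (n : ℝ) ^ η) := by positivity
      linarith
    · push Not at hg
      have h1 := (hmain (tie ω) (fun p a j => X p a j ω) n κ (∑ d ∈ E, F d ω)
        (fun t p B => htie.mem ω t p B) hκ1 hFs (fun p a j hp hj => by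
          rw [← hZeq (p, a) j ω]
          refine ⟨not_lt.mp (hg _ (hEmem p hp a) j hj), (hZF _ ω j hj).trans ?_⟩
          exact Finset.single_le_sum (f := fun d => F d ω) (fun d _ => hF0 d ω)
            (hEmem p hp a)) n le_rfl).2
      rw [run_N_root] at h1
      refine h1.trans ?_
      have h2 : C * (∑ d ∈ E, F d ω + (n : ℝ) ^ η + κ ^ e) ≤
          C * (∑ d ∈ E, F d ω + 2 * (n : ℝ) ^ η) :=
        mul_le_mul_of_nonneg_left (by linarith) hC
      have h3 : 0 ≤ n * Q * ∑ d ∈ E, ∑ j ∈ Finset.range (n + 1),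
          (bad d j).indicator (fun _ => (1 : ℝ)) ω :=
        mul_nonneg (by positivity) (Finset.sum_nonneg fun d _ => Finset.sum_nonneg fun j _ => hind d j)
      linarith
  have iF : Integrable (fun ω => ∑ d ∈ E, F d ω) P := integrable_finsetSum _ fun d _ => (hFi d).1
  have ibad : ∀ d j, Integrable ((bad d j).indicator fun _ => (1 : ℝ)) P := fun d j =>
    (integrable_const 1).indicator (hbadm d j)
  have ibads : ∀ d, Integrable (fun ω => ∑ j ∈ Finset.range (n + 1),
      (bad d j).indicator (fun _ => (1 : ℝ)) ω) P := fun d => integrable_finsetSum _ fun j _ => ibad d j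
  have ibadss : Integrable (fun ω => ∑ d ∈ E, ∑ j ∈ Finset.range (n + 1),
      (bad d j).indicator (fun _ => (1 : ℝ)) ω) P := integrable_finsetSum _ fun d _ => ibads d
  have iA : Integrable (fun ω => C * (∑ d ∈ E, F d ω + 2 * (n : ℝ) ^ η)) P :=
    (iF.add (integrable_const _)).const_mul C
  have hint := integral_mono_ae ((hVi.sub (integrable_const _)).abs)
    (iA.add (ibadss.const_mul (n * Q))) hpt
  simp only [Pi.add_apply] at hint
  rw [integral_add iA (ibadss.const_mul (n * Q)), integral_const_mul, integral_const_mul,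
    integral_add iF (integrable_const _), integral_finsetSum _ fun d _ => (hFi d).1,
    integral_finsetSum _ fun d _ => ibads d] at hint
  have hFsum : ∑ d ∈ E, ∫ ω, F d ω ∂P ≤ E.card * (2 * D) * (n : ℝ) ^ η := by
    have h1 : (n : ℝ) ^ (1 / 2 : ℝ) ≤ (n : ℝ) ^ η := Real.rpow_le_rpow_of_exponent_le hn1 hη
    have h2 : ∀ d ∈ E, ∫ ω, F d ω ∂P ≤ 2 * D * (n : ℝ) ^ η := fun d _ =>
      (hFi d).2.trans (by gcongr)
    have := Finset.sum_le_card_nsmul E _ _ h2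
    rw [nsmul_eq_mul] at this
    linarith
  have hbadsum : n * Q * ∑ d ∈ E, ∫ ω, ∑ j ∈ Finset.range (n + 1),
      (bad d j).indicator (fun _ => (1 : ℝ)) ω ∂P ≤ Q * (E.card * (2 * K)) := by
    have h1 : ∀ d ∈ E, ∫ ω, ∑ j ∈ Finset.range (n + 1),
        (bad d j).indicator (fun _ => (1 : ℝ)) ω ∂P ≤
        (n + 1) * (2 * Real.exp (-(κ ^ 2 / (2 * (2 * M.Rmax) ^ 2)))) := by
      intro d _
      rw [integral_finsetSum _ fun j _ => ibad d j]
      have := Finset.sum_le_card_nsmul (Finset.range (n + 1))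
        (fun j => ∫ ω, (bad d j).indicator (fun _ => (1 : ℝ)) ω ∂P) _ fun j _ => by
          rw [integral_indicator_const _ (hbadm d j), smul_eq_mul, mul_one]
          exact hbadP d j
      rw [nsmul_eq_mul, Finset.card_range] at this
      exact_mod_cast this
    have h2 := Finset.sum_le_card_nsmul E _ _ h1
    rw [nsmul_eq_mul] at h2
    have h3 := hKn n hn
    calc _ ≤ n * Q * (E.card * ((n + 1) *
          (2 * Real.exp (-(κ ^ 2 / (2 * (2 * M.Rmax) ^ 2)))))) := by gcongr
      _ = Q * (E.card * (2 * (n * (n + 1) *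
          Real.exp (-(κ ^ 2 / (2 * (2 * M.Rmax) ^ 2)))))) := by ring
      _ ≤ _ := by gcongr
  have htot : ∫ ω, |V ω - n * W| ∂P ≤
      (C * (E.card * (2 * D) + 2) + Q * (E.card * (2 * K))) * (n : ℝ) ^ η := by
    simp only [integral_const, probReal_univ, smul_eq_mul, one_mul] at hint
    have h1 : C * (∑ d ∈ E, ∫ ω, F d ω ∂P + 2 * (n : ℝ) ^ η) ≤
        C * (E.card * (2 * D) * (n : ℝ) ^ η + 2 * (n : ℝ) ^ η) :=
      mul_le_mul_of_nonneg_left (by linarith) hC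
    have h2 : Q * (E.card * (2 * K)) * 1 ≤ Q * (E.card * (2 * K)) * (n : ℝ) ^ η := by gcongr
    have h0 : ∫ ω, |V ω - n * W| ∂P ≤ _ := hint
    linarith
  have hout : ∀ ω, |output M Vhat s c (tie ω) (fun p a j => X p a j ω) H n - W| =
      |V ω - n * W| / n := by
    intro ω
    rw [output, ← abs_of_pos hn0, ← abs_div, abs_of_pos hn0, sub_div,
      mul_div_cancel_left₀ _ hn0.ne']
  simp only [hout]
  rw [integral_div, Real.rpow_sub_one hn0.ne', ← mul_div_assoc]
  gcongr

end Final

end MCTS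

/-! ### Choice of the constants and conclusion. -/

theorem theorem1 {S A : Type*} [Fintype A] [Nonempty A] (M : MCTS.MDP S A)
    (Vhat : S → ℝ) (hV : ∃ B : ℝ, ∀ s, |Vhat s| ≤ B)
    (H : ℕ) (hH : 1 ≤ H) (η : ℝ) (hη : 1 / 2 ≤ η) (hη1 : η < 1)
    (α ξ : ℕ → ℝ)
    (hαH : α H = η * (1 - η) * ξ H)
    (hα : ∀ h, 1 ≤ h → h < H → α h = η * (1 - η) * (α (h + 1) - 1))
    (hξ : ∀ h, 1 ≤ h → h < H → ξ h = α (h + 1) - 1)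
    (hα1 : 2 < α 1) :
    ∃ β : ℕ → ℝ, (∀ h, 1 ≤ h → h ≤ H → 1 < β h) ∧
      ∀ s : S, ∃ C : ℝ,
        ∀ (Ω : Type*) [MeasurableSpace Ω] (P : Measure Ω) [IsProbabilityMeasure P]
          (X : List A → A → ℕ → Ω → ℝ) (tie : Ω → MCTS.TieRule A),
          MCTS.IsRewardSample M s P X → MCTS.IsTieRule tie →
          ∀ n : ℕ, 1 ≤ n →
            Integrable (fun ω => MCTS.output M Vhat s ⟨α, β, ξ, fun _ => η⟩ (tie ω)
              (fun p a j => X p a j ω) H n) P ∧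
            |(∫ ω, MCTS.output M Vhat s ⟨α, β, ξ, fun _ => η⟩ (tie ω)
                (fun p a j => X p a j ω) H n ∂P) - M.optValue s| ≤
              M.γ ^ H * (⨆ s' : S, |Vhat s' - M.optValue s'|) + C * (n : ℝ) ^ (η - 1) := by
  have hs : 0 < η * (1 - η) := mul_pos (by linarith) (by linarith)
  have hs1 : η * (1 - η) ≤ 1 := by nlinarith
  -- The recursions give the same ratio `α/ξ` at every level, hence the same exponent of the bonus.
  have hαξ : ∀ h, 1 ≤ h → h ≤ H → α h = η * (1 - η) * ξ h := by
    intro h h1 h2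
    rcases h2.eq_or_lt with rfl | h3
    · exact hαH
    · rw [hα h h1 h3, hξ h h1 h3]
  -- As `η(1-η) ≤ 1`, the bound at the root level propagates towards the leaves; it serves to make
  -- every `ξ h` positive.
  have hαpos : ∀ h, 1 ≤ h → h ≤ H → 2 < α h := by
    intro h h1
    induction h, h1 using Nat.le_induction with
    | base => exact fun _ => hα1
    | succ h h1 ih =>
      intro h2
      have h3 := ih (by omega)
      rw [hα h h1 (by omega)] at h3
      by_contra h4
      have : η * (1 - η) * (α (h + 1) - 1) ≤ η * (1 - η) * 1 :=
        mul_le_mul_of_nonneg_left (by linarith) hs.le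
      linarith
  have hξpos : ∀ h, 1 ≤ h → h ≤ H → 0 < ξ h := by
    intro h h1 h2
    have h3 := hαpos h h1 h2
    rw [hαξ h h1 h2] at h3
    exact pos_of_mul_pos_right (by linarith) hs.le
  -- Only `β ^ (1/ξ) ≥ 1` is needed, so `2` will do.
  refine ⟨fun _ => 2, fun _ _ _ => one_lt_two, fun s => ?_⟩
  obtain ⟨C, hC⟩ := MCTS.exists_integral_abs_output_sub_le M Vhat s ⟨α, fun _ => 2, ξ, fun _ => η⟩ H
    hV hη hη1 (fun _ => rfl)
    (fun h h1 h2 => by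
      have := hξpos h h1 h2
      rw [div_eq_iff this.ne']
      exact hαξ h h1 h2)
    (fun h h1 h2 => Real.one_le_rpow one_le_two (one_div_nonneg.mpr (hξpos h h1 h2).le))
  refine ⟨C, fun Ω _ P _ X tie hX htie n hn => ?_⟩
  obtain ⟨hi, hb⟩ := hC Ω P X tie hX htie n hn
  refine ⟨hi, ?_⟩
  -- Without boundedness the real `⨆` would take the default value `0` and not dominate its terms.
  have hbdd : BddAbove (Set.range fun s' : S => |Vhat s' - M.optValue s'|) := by
    obtain ⟨B, hB⟩ := hV
    refine ⟨B + M.Rmax / (1 - M.γ), ?_⟩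
    rintro _ ⟨s', rfl⟩
    exact (abs_sub _ _).trans (add_le_add (hB s') (M.abs_optValue_le s'))
  have h1 := M.abs_bellmanIter_sub_optValue_le Vhat (fun s' => le_ciSup hbdd s') H s
  have h2 := norm_integral_le_integral_norm (μ := P) fun ω =>
    MCTS.output M Vhat s ⟨α, fun _ => 2, ξ, fun _ => η⟩ (tie ω) (fun p a j => X p a j ω) H n -
      M.bellmanIter Vhat H s
  rw [integral_sub hi (integrable_const _)] at h2
  simp only [Real.norm_eq_abs, integral_const, probReal_univ, smul_eq_mul, one_mul] at h2
  have h3 := abs_sub_le (∫ ω, MCTS.output M Vhat s ⟨α, fun _ => 2, ξ, fun _ => η⟩ (tie ω)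
    (fun p a j => X p a j ω) H n ∂P) (M.bellmanIter Vhat H s) (M.optValue s)
  linarith
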